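/- Let $K$ be a natural number and let $h_1,\dots,h_K,g_1,\dots,g_K$ be independent and identically distributed nonnegative random variables, each having a probability density function, with $\mathbb{E}[\ln(1+h_i)]<\infty$. Here $h_i$ is the channel power gain from secondary user $i$ to the secondary base station, and $g_i$ is the channel power gain from user $i$ to the primary receiver. Let $\sigma^2>0$ be the noise power, and let $P_1^{av},\dots,P_K^{av}\ge 0$ and $I^{av}\ge 0$ be power limits. A power allocation is a measurable function $P=(P_1,\dots,P_K)$ of the fading state $(h,g)$ with $P_i\ge 0$; it is feasible if $$\mathbb{E}[P_i]\le P_i^{av}\ \text{ for all } i,\qquad \mathbb{E}\Big[\sum_{i=1}^K g_iP_i\Big]\le I^{av}.$$ Consider the two problems of maximizing, over all feasible power allocations, the ergodic sum-rate without successive interference cancellation (SIC) $$\text{(Problem 1)}\qquad \mathbb{E}\Big[\sum_{i=1}^K \ln\Big(1+\frac{h_iP_i}{\sigma^2+\sum_{j\ne i}h_jP_j}\Big)\Big]$$ and the ergodic sum-rate with SIC $$\text{(Problem 2)}\qquad \mathbb{E}\Big[\ln\Big(1+\sum_{i=1}^K \frac{h_iP_i}{\sigma^2}\Big)\Big].$$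 **Theorem.** Both objectives are finite for every feasible power allocation. Problem 1 has an optimal solution, and a power allocation is optimal for Problem 1 if and only if it is optimal for Problem 2. The optimal solution is unique up to almost sure equality, and it is dynamic TDMA: almost surely, at most one user transmits (has $P_i>0$) in a fading block. -/

import Mathlib

open MeasureTheory ProbabilityTheory

/-- A fading state of a `K`-user channel: the gains `h` of the secondary links (first component)
and the gains `g` of the interference links (second component). -/
abbrev FadingState (K : ℕ) : Type := (Fin K → ℝ) × (Fin K → ℝ)

/-- A power allocation strategy: the vector of transmit powers used in each fading state. -/
abbrev PowerAllocation (K : ℕ) : Type := FadingState K → Fin K → ℝ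

/-- The instantaneous sum-rate without successive interference cancellation, for noise power `N`,
gains `h` and transmit powers `p`. -/
noncomputable def sumRateNoSIC {K : ℕ} (N : ℝ) (h p : Fin K → ℝ) : ℝ :=
  ∑ i, Real.log (1 + h i * p i / (N + ∑ j ∈ Finset.univ.erase i, h j * p j))

/-- The instantaneous sum-rate with successive interference cancellation. -/
noncomputable def sumRateSIC {K : ℕ} (N : ℝ) (h p : Fin K → ℝ) : ℝ :=
  Real.log (1 + ∑ i, h i * p i / N)

section Fading

variable {Ω : Type*} [MeasurableSpace Ω] {K : ℕ}

/-- The random fading state with secondary gains `h` and interference gains `g`. -/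
def fadingState (h g : Fin K → Ω → ℝ) (ω : Ω) : FadingState K :=
  (fun i => h i ω, fun i => g i ω)

/-- The power allocations satisfying the average transmit power constraints `E[P_i] ≤ Pav i` and
the average interference power constraint `E[∑ g_i P_i] ≤ Iav`. -/
def feasibleSet (μ : Measure Ω) (h g : Fin K → Ω → ℝ) (Pav : Fin K → ℝ) (Iav : ℝ) :
    Set (PowerAllocation K) :=
  {P | Measurable P ∧ (∀ s i, 0 ≤ P s i) ∧
    (∀ i, Integrable (fun ω => P (fadingState h g ω) i) μ ∧
      ∫ ω, P (fadingState h g ω) i ∂μ ≤ Pav i) ∧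
    (Integrable (fun ω => ∑ i, g i ω * P (fadingState h g ω) i) μ ∧
      ∫ ω, ∑ i, g i ω * P (fadingState h g ω) i ∂μ ≤ Iav)}

/-- The ergodic sum-rate without successive interference cancellation. -/
noncomputable def ergodicSumRateNoSIC (μ : Measure Ω) (h g : Fin K → Ω → ℝ) (N : ℝ)
    (P : PowerAllocation K) : ℝ :=
  ∫ ω, sumRateNoSIC N (fun i => h i ω) (P (fadingState h g ω)) ∂μ

/-- The ergodic sum-rate with successive interference cancellation. -/
noncomputable def ergodicSumRateSIC (μ : Measure Ω) (h g : Fin K → Ω → ℝ) (N : ℝ)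
    (P : PowerAllocation K) : ℝ :=
  ∫ ω, sumRateSIC N (fun i => h i ω) (P (fadingState h g ω)) ∂μ

/-- `P` is an optimal solution of the problem without successive interference cancellation. -/
def IsOptimalNoSIC (μ : Measure Ω) (h g : Fin K → Ω → ℝ) (N : ℝ) (Pav : Fin K → ℝ) (Iav : ℝ)
    (P : PowerAllocation K) : Prop :=
  P ∈ feasibleSet μ h g Pav Iav ∧
    IsMaxOn (ergodicSumRateNoSIC μ h g N) (feasibleSet μ h g Pav Iav) P

/-- `P` is an optimal solution of the problem with successive interference cancellation. -/
def IsOptimalSIC (μ : Measure Ω) (h g : Fin K → Ω → ℝ) (N : ℝ) (Pav : Fin K → ℝ) (Iav : ℝ)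
    (P : PowerAllocation K) : Prop :=
  P ∈ feasibleSet μ h g Pav Iav ∧
    IsMaxOn (ergodicSumRateSIC μ h g N) (feasibleSet μ h g Pav Iav) P

/-- Dynamic TDMA: almost surely, at most one user transmits in the fading block. -/
def IsDynamicTDMA (μ : Measure Ω) (h g : Fin K → Ω → ℝ) (P : PowerAllocation K) : Prop :=
  ∀ᵐ ω ∂μ, ∀ i j, 0 < P (fadingState h g ω) i → 0 < P (fadingState h g ω) j → i = j

end Fading

/-! Pointwise, the rate without SIC is at most the rate with SIC, with equality when at most one
user transmits (`sumRateNoSIC_le_sumRateSIC`, `sumRateNoSIC_eq_sumRateSIC`). It therefore suffices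
that the SIC problem has a maximizer and that each of its maximizers is TDMA; the two problems then
have the same maximizers.

Existence is the direct method. Superlevel sets of the concave SIC objective are midpoint-convex and
bounded in L¹. Minimizing the convex functional `∫ ∑ exp (-P i)` over shrinking superlevel sets
selects a sequence converging almost everywhere (`exists_seq_mem_tendsto_ae`). Fatou's lemma keeps
the limit feasible, and the sublinear growth of the logarithm prevents a loss of rate in the limit
(`le_integral_sumRateSIC_of_tendsto_ae`).

For TDMA, suppose users `i` and `j` both transmit on a set of positive measure. Change their powers
there by multiples of `h j * d + 1` and `-(h i * d)`: the received power grows by a multiple of `h i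
> 0` whatever `d` is, while preserving the three averages imposes only three linear conditions on
`d`. They are solvable when `h j`, `h i` and `g i * h j - g j * h i` are linearly independent on the
set, which independence and the densities guarantee (`ae_gain_combination_ne_zero`). This
contradicts maximality.

For uniqueness, the midpoint of two maximizers is a maximizer, hence TDMA, so both use the same
user; strict concavity equates their received powers, hence their powers. -/

/-! ### Pointwise inequalities for the two sum-rates -/

theorem one_sub_sum_le_prod_one_sub {ι : Type*} (s : Finset ι) (u : ι → ℝ)
    (h0 : ∀ i ∈ s, 0 ≤ u i) (h1 : ∀ i ∈ s, u i ≤ 1) :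
    1 - ∑ i ∈ s, u i ≤ ∏ i ∈ s, (1 - u i) := by
  classical
  -- The upper bound by 1 is carried along because the induction step needs `u a * ∏ ≤ u a`.
  have key : 1 - ∑ i ∈ s, u i ≤ ∏ i ∈ s, (1 - u i) ∧ ∏ i ∈ s, (1 - u i) ≤ 1 := by
    induction s using Finset.induction_on with
    | empty => simp
    | insert a s ha ih =>
      obtain ⟨ih1, ih2⟩ := ih (fun i hi => h0 i (Finset.mem_insert_of_mem hi))
        (fun i hi => h1 i (Finset.mem_insert_of_mem hi))
      have ha0 := h0 a (Finset.mem_insert_self a s)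
      have ha1 := h1 a (Finset.mem_insert_self a s)
      have hp : 0 ≤ ∏ i ∈ s, (1 - u i) := Finset.prod_nonneg fun i hi =>
        sub_nonneg.2 (h1 i (Finset.mem_insert_of_mem hi))
      rw [Finset.sum_insert ha, Finset.prod_insert ha]
      constructor <;> nlinarith
  exact key.1

section SumRates

variable {K : ℕ} {N : ℝ} {h p q : Fin K → ℝ}

theorem sumRateSIC_eq_log (N : ℝ) (h p : Fin K → ℝ) :
    sumRateSIC N h p = Real.log (1 + (∑ i, h i * p i) / N) := by
  simp only [sumRateSIC, Finset.sum_div]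

theorem weightedPower_nonneg (hh : ∀ i, 0 ≤ h i) (hp : ∀ i, 0 ≤ p i) : 0 ≤ ∑ i, h i * p i :=
  Finset.sum_nonneg fun i _ => mul_nonneg (hh i) (hp i)

theorem sumRateSIC_nonneg (hN : 0 < N) (hh : ∀ i, 0 ≤ h i) (hp : ∀ i, 0 ≤ p i) :
    0 ≤ sumRateSIC N h p := by
  rw [sumRateSIC_eq_log]
  apply Real.log_nonneg
  have := weightedPower_nonneg hh hp
  have : 0 ≤ (∑ i, h i * p i) / N := by positivity
  linarith

theorem sumRateNoSIC_nonneg (hN : 0 < N) (hh : ∀ i, 0 ≤ h i) (hp : ∀ i, 0 ≤ p i) :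
    0 ≤ sumRateNoSIC N h p := by
  refine Finset.sum_nonneg fun i _ => Real.log_nonneg ?_
  have h1 : 0 ≤ ∑ j ∈ Finset.univ.erase i, h j * p j :=
    Finset.sum_nonneg fun j _ => mul_nonneg (hh j) (hp j)
  have h2 := mul_nonneg (hh i) (hp i)
  have : 0 ≤ h i * p i / (N + ∑ j ∈ Finset.univ.erase i, h j * p j) := by positivity
  linarith

/-- With `u i = h i * p i / (N + S)`, the fraction of the total power received from user `i`, the
two rates are `-log ∏ (1 - u i)` and `-log (1 - ∑ u i)`, so the Weierstrass product inequality
compares them. -/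
theorem sumRateNoSIC_le_sumRateSIC (hN : 0 < N) (hh : ∀ i, 0 ≤ h i) (hp : ∀ i, 0 ≤ p i) :
    sumRateNoSIC N h p ≤ sumRateSIC N h p := by
  have hS := weightedPower_nonneg hh hp
  set S := ∑ i, h i * p i with hSdef
  have hT : 0 < N + S := by linarith
  have hrest : ∀ i, ∑ j ∈ Finset.univ.erase i, h j * p j = S - h i * p i := fun i => by
    rw [hSdef, ← Finset.add_sum_erase _ _ (Finset.mem_univ i)]; ring
  have hrest0 : ∀ i, 0 ≤ S - h i * p i := fun i => by
    rw [← hrest]; exact Finset.sum_nonneg fun j _ => mul_nonneg (hh j) (hp j)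
  have hx : ∀ i, 0 ≤ h i * p i := fun i => mul_nonneg (hh i) (hp i)
  have hu : ∀ i, 0 < 1 - h i * p i / (N + S) := fun i => by
    rw [sub_pos, div_lt_one hT]; linarith [hrest0 i]
  have h1 : sumRateNoSIC N h p = -Real.log (∏ i, (1 - h i * p i / (N + S))) := by
    rw [Real.log_prod fun i _ => (hu i).ne', ← Finset.sum_neg_distrib]
    refine Finset.sum_congr rfl fun i _ => ?_
    rw [hrest, ← Real.log_inv]
    congr 1
    have : N + (S - h i * p i) ≠ 0 := by linarith [hrest0 i]
    have h3 : N + S - h i * p i ≠ 0 := by rwa [add_sub_assoc]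
    field_simp
    ring
  have h2 : sumRateSIC N h p = -Real.log (1 - ∑ i, h i * p i / (N + S)) := by
    rw [sumRateSIC_eq_log, ← Real.log_inv, ← Finset.sum_div, ← hSdef]
    congr 1
    have : N + S - S ≠ 0 := by simpa using hN.ne'
    field_simp
    ring
  rw [h1, h2, neg_le_neg_iff]
  apply Real.log_le_log
  · rw [← Finset.sum_div, ← hSdef, sub_pos, div_lt_one hT]; linarith
  · exact one_sub_sum_le_prod_one_sub _ _ (fun i _ => div_nonneg (hx i) hT.le)
      fun i _ => by linarith [hu i]

theorem sumRateNoSIC_eq_sumRateSIC (hp : ∀ i, 0 ≤ p i)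
    (hone : ∀ i j, 0 < p i → 0 < p j → i = j) : sumRateNoSIC N h p = sumRateSIC N h p := by
  by_cases hex : ∃ i, 0 < p i
  · obtain ⟨i, hi⟩ := hex
    have h0 : ∀ j, j ≠ i → p j = 0 := fun j hj =>
      ((hp j).eq_or_lt.resolve_right fun hlt => hj (hone j i hlt hi)).symm
    have hrest : ∑ j ∈ Finset.univ.erase i, h j * p j = 0 :=
      Finset.sum_eq_zero fun j hj => by simp [h0 j (Finset.ne_of_mem_erase hj)]
    rw [sumRateNoSIC, sumRateSIC, Fintype.sum_eq_single i fun j hj => by simp [h0 j hj], hrest,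
      add_zero, Fintype.sum_eq_single (f := fun j => h j * p j / N) i
        fun j hj => by simp [h0 j hj]]
  · push Not at hex
    have h0 : ∀ i, p i = 0 := fun i => le_antisymm (hex i) (hp i)
    simp [sumRateNoSIC, sumRateSIC, h0]

theorem weightedPower_midpoint (h p q : Fin K → ℝ) :
    ∑ i, h i * ((p i + q i) / 2) = (∑ i, h i * p i + ∑ i, h i * q i) / 2 := by
  rw [← Finset.sum_add_distrib, Finset.sum_div]
  exact Finset.sum_congr rfl fun i _ => by ring

theorem sumRateSIC_midpoint (hN : 0 < N) (hh : ∀ i, 0 ≤ h i) (hp : ∀ i, 0 ≤ p i)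
    (hq : ∀ i, 0 ≤ q i) :
    (sumRateSIC N h p + sumRateSIC N h q) / 2 ≤ sumRateSIC N h (fun i => (p i + q i) / 2) := by
  have hx := weightedPower_nonneg hh hp
  have hy := weightedPower_nonneg hh hq
  simp only [sumRateSIC_eq_log, weightedPower_midpoint]
  have h1 : 0 < 1 + (∑ i, h i * p i) / N := by positivity
  have h2 : 0 < 1 + (∑ i, h i * q i) / N := by positivity
  have := strictConcaveOn_log_Ioi.concaveOn.2 (Set.mem_Ioi.2 h1) (Set.mem_Ioi.2 h2)
    (by norm_num : (0 : ℝ) ≤ 1 / 2) (by norm_num : (0 : ℝ) ≤ 1 / 2) (by norm_num)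
  simp only [smul_eq_mul] at this
  have e : 1 + (∑ i, h i * p i + ∑ i, h i * q i) / 2 / N =
      1 / 2 * (1 + (∑ i, h i * p i) / N) + 1 / 2 * (1 + (∑ i, h i * q i) / N) := by ring
  rw [e]
  linarith

theorem weightedPower_eq_of_sumRateSIC_midpoint_eq (hN : 0 < N) (hh : ∀ i, 0 ≤ h i)
    (hp : ∀ i, 0 ≤ p i) (hq : ∀ i, 0 ≤ q i)
    (heq : (sumRateSIC N h p + sumRateSIC N h q) / 2 =
      sumRateSIC N h (fun i => (p i + q i) / 2)) :
    ∑ i, h i * p i = ∑ i, h i * q i := by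
  by_contra hne
  have hx := weightedPower_nonneg hh hp
  have hy := weightedPower_nonneg hh hq
  simp only [sumRateSIC_eq_log, weightedPower_midpoint] at heq
  have h1 : 0 < 1 + (∑ i, h i * p i) / N := by positivity
  have h2 : 0 < 1 + (∑ i, h i * q i) / N := by positivity
  have := strictConcaveOn_log_Ioi.2 (Set.mem_Ioi.2 h1) (Set.mem_Ioi.2 h2)
    (fun hc => hne (by simpa [hN.ne'] using hc))
    (by norm_num : (0 : ℝ) < 1 / 2) (by norm_num : (0 : ℝ) < 1 / 2) (by norm_num)
  simp only [smul_eq_mul] at this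
  refine absurd heq (ne_of_lt ?_)
  have e : 1 + (∑ i, h i * p i + ∑ i, h i * q i) / 2 / N =
      1 / 2 * (1 + (∑ i, h i * p i) / N) + 1 / 2 * (1 + (∑ i, h i * q i) / N) := by ring
  rw [e]
  linarith

theorem sumRateSIC_lt (hN : 0 < N) (hp : 0 ≤ ∑ i, h i * p i)
    (hlt : ∑ i, h i * p i < ∑ i, h i * q i) : sumRateSIC N h p < sumRateSIC N h q := by
  simp only [sumRateSIC_eq_log]
  apply Real.log_lt_log (by positivity)
  gcongr

theorem log_one_add_sum_le {ι : Type*} (s : Finset ι) (x : ι → ℝ) (hx : ∀ i ∈ s, 0 ≤ x i) :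
    Real.log (1 + ∑ i ∈ s, x i) ≤ ∑ i ∈ s, Real.log (1 + x i) := by
  classical
  induction s using Finset.induction_on with
  | empty => simp
  | insert a s ha ih =>
    have hs : ∀ i ∈ s, 0 ≤ x i := fun i hi => hx i (Finset.mem_insert_of_mem hi)
    have ha0 := hx a (Finset.mem_insert_self a s)
    have hs0 : 0 ≤ ∑ i ∈ s, x i := Finset.sum_nonneg hs
    rw [Finset.sum_insert ha, Finset.sum_insert ha]
    refine le_trans ?_ (add_le_add_right (ih hs) _)
    rw [← Real.log_mul (by positivity) (by positivity)]
    apply Real.log_le_log (by positivity)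
    nlinarith [mul_nonneg ha0 hs0]

/-- Separates gains from powers through `1 + h * p / N ≤ (1 + h) * (1 + p / N)`, so that a
log-moment of the gains and a first moment of the powers suffice for integrability. -/
theorem sumRateSIC_le_sum (hN : 0 < N) (hh : ∀ i, 0 ≤ h i) (hp : ∀ i, 0 ≤ p i) :
    sumRateSIC N h p ≤ ∑ i, (Real.log (1 + h i) + Real.log (1 + p i / N)) := by
  refine (log_one_add_sum_le _ _ fun i _ => ?_).trans (Finset.sum_le_sum fun i _ => ?_)
  · exact div_nonneg (mul_nonneg (hh i) (hp i)) hN.le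
  · have h1 := hh i
    have h2 : 0 ≤ p i / N := div_nonneg (hp i) hN.le
    rw [← Real.log_mul (by positivity) (by positivity), mul_div_assoc]
    apply Real.log_le_log (by positivity)
    nlinarith

/-- This is `log y ≤ y - 1` at `y = ε * N * (1 + x / N)`. The slope `ε` is arbitrarily small, which
later controls power concentrating on small sets. -/
theorem log_one_add_div_le (hN : 0 < N) {ε : ℝ} (hε : 0 < ε) {x : ℝ} (hx : 0 ≤ x) :
    Real.log (1 + x / N) ≤ ε * x + (ε * N + |Real.log (ε * N)|) := by
  have h1 : 0 < 1 + x / N := by positivity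
  have h2 : 0 < ε * N := by positivity
  have h3 := Real.log_le_sub_one_of_pos (mul_pos h2 h1)
  rw [Real.log_mul h2.ne' h1.ne'] at h3
  have h4 : ε * N * (1 + x / N) = ε * N + ε * x := by field_simp
  linarith [neg_abs_le (Real.log (ε * N))]

end SumRates

/-! ### Consequences of Fatou's lemma and the L² distance -/

open Filter Topology in
theorem integrable_and_integral_le_of_tendsto_ae {X : Type*} [MeasurableSpace X] {ν : Measure X}
    {f : ℕ → X → ℝ} {F : X → ℝ} {c : ℕ → ℝ} {C : ℝ} (hf : ∀ n, Integrable (f n) ν)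
    (h0 : ∀ n, 0 ≤ᵐ[ν] f n) (hc : ∀ n, ∫ s, f n s ∂ν ≤ c n) (hC : Tendsto c atTop (𝓝 C))
    (hF : AEStronglyMeasurable F ν)
    (hlim : ∀ᵐ s ∂ν, Tendsto (fun n => f n s) atTop (𝓝 (F s))) :
    Integrable F ν ∧ ∫ s, F s ∂ν ≤ C := by
  have hF0 : 0 ≤ᵐ[ν] F := by
    filter_upwards [hlim, ae_all_iff.2 h0] with s hs h0s
    exact ge_of_tendsto' hs h0s
  have hC0 : 0 ≤ C := ge_of_tendsto' hC fun n => (integral_nonneg_of_ae (h0 n)).trans (hc n)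
  have hle : ∫⁻ s, ENNReal.ofReal (F s) ∂ν ≤ ENNReal.ofReal C := by
    calc ∫⁻ s, ENNReal.ofReal (F s) ∂ν
        = ∫⁻ s, liminf (fun n => ENNReal.ofReal (f n s)) atTop ∂ν := by
          refine lintegral_congr_ae ?_
          filter_upwards [hlim] with s hs
          exact (ENNReal.tendsto_ofReal hs).liminf_eq.symm
      _ ≤ liminf (fun n => ∫⁻ s, ENNReal.ofReal (f n s) ∂ν) atTop :=
          lintegral_liminf_le' fun n => (hf n).1.aemeasurable.ennreal_ofReal
      _ ≤ liminf (fun n => ENNReal.ofReal (c n)) atTop := by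
          refine liminf_le_liminf (Eventually.of_forall fun n => ?_)
          rw [← ofReal_integral_eq_lintegral_ofReal (hf n) (h0 n)]
          exact ENNReal.ofReal_le_ofReal (hc n)
      _ = ENNReal.ofReal C := (ENNReal.tendsto_ofReal hC).liminf_eq
  refine ⟨(lintegral_ofReal_ne_top_iff_integrable hF hF0).1
    (hle.trans_lt ENNReal.ofReal_lt_top).ne, ?_⟩
  rw [integral_eq_lintegral_of_nonneg_ae hF0 hF]
  exact ENNReal.toReal_le_of_le_ofReal hC0 hle

-- Used to exclude that the powers tend to infinity at a point along the selected subsequence.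
open Filter Topology in
theorem ae_liminf_ofReal_lt_top {X : Type*} [MeasurableSpace X] {ν : Measure X}
    {f : ℕ → X → ℝ} {C : ℝ} (hm : ∀ n, Measurable (f n)) (hf : ∀ n, Integrable (f n) ν) (h0 : ∀ n, 0 ≤ᵐ[ν] f n)
    (hC : ∀ n, ∫ s, f n s ∂ν ≤ C) :
    ∀ᵐ s ∂ν, liminf (fun n => ENNReal.ofReal (f n s)) atTop < ⊤ := by
  have hle : ∫⁻ s, liminf (fun n => ENNReal.ofReal (f n s)) atTop ∂ν ≤ ENNReal.ofReal C := by
    refine (lintegral_liminf_le' fun n => (hf n).1.aemeasurable.ennreal_ofReal).trans ?_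
    calc liminf (fun n => ∫⁻ s, ENNReal.ofReal (f n s) ∂ν) atTop
        ≤ liminf (fun _ : ℕ => ENNReal.ofReal C) atTop := by
          refine liminf_le_liminf (Eventually.of_forall fun n => ?_)
          rw [← ofReal_integral_eq_lintegral_ofReal (hf n) (h0 n)]
          exact ENNReal.ofReal_le_ofReal (hC n)
      _ = ENNReal.ofReal C := liminf_const _
  refine ae_lt_top' ?_ (hle.trans_lt ENNReal.ofReal_lt_top).ne
  exact (Measurable.liminf fun n => (hm n).ennreal_ofReal).aemeasurable

theorem dist_toLp_eq_sqrt {X E : Type*} [MeasurableSpace X] {ν : Measure X}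
    [NormedAddCommGroup E] {f g : X → E} (hf : MemLp f 2 ν) (hg : MemLp g 2 ν) :
    dist (hf.toLp f) (hg.toLp g) = Real.sqrt (∫ s, ‖f s - g s‖ ^ 2 ∂ν) := by
  rw [dist_eq_norm, ← MemLp.toLp_sub, Lp.norm_toLp,
    (hf.sub hg).eLpNorm_eq_integral_rpow_norm (by norm_num) (by norm_num),
    ENNReal.toReal_ofReal (by positivity), Real.sqrt_eq_rpow]
  norm_num

/-! ### Almost everywhere convergent selections from convex sets -/

section Compactness

variable {X : Type*} [MeasurableSpace X] {K : ℕ}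

/-- Quantitative convexity of `exp (-x)`: its midpoint gap is exactly the square of the difference
of the values of `exp (-x / 2)`. The norm on the left is the sup norm, which is at most the
Euclidean one. -/
theorem exp_midpoint_gap (p q : Fin K → ℝ) :
    ‖(fun i => Real.exp (-p i / 2)) - fun i => Real.exp (-q i / 2)‖ ^ 2 ≤
      ∑ i, Real.exp (-p i) + ∑ i, Real.exp (-q i) - 2 * ∑ i, Real.exp (-((p i + q i) / 2)) := by
  have hrw : ∑ i, Real.exp (-p i) + ∑ i, Real.exp (-q i)
      - 2 * ∑ i, Real.exp (-((p i + q i) / 2)) =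
      ∑ i, (Real.exp (-p i / 2) - Real.exp (-q i / 2)) ^ 2 := by
    rw [Finset.mul_sum, ← Finset.sum_add_distrib, ← Finset.sum_sub_distrib]
    refine Finset.sum_congr rfl fun i _ => ?_
    have h1 : Real.exp (-p i) = Real.exp (-p i / 2) ^ 2 := by
      rw [← Real.exp_nat_mul]; congr 1; push_cast; ring
    have h2 : Real.exp (-q i) = Real.exp (-q i / 2) ^ 2 := by
      rw [← Real.exp_nat_mul]; congr 1; push_cast; ring
    have h3 : Real.exp (-((p i + q i) / 2)) = Real.exp (-p i / 2) * Real.exp (-q i / 2) := by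
      rw [← Real.exp_add]; congr 1; ring
    rw [h1, h2, h3]; ring
  rw [hrw]
  have hnn : 0 ≤ ∑ i, (Real.exp (-p i / 2) - Real.exp (-q i / 2)) ^ 2 :=
    Finset.sum_nonneg fun i _ => sq_nonneg _
  rw [← Real.le_sqrt (norm_nonneg _) hnn, pi_norm_le_iff_of_nonneg (Real.sqrt_nonneg _)]
  intro i
  apply Real.le_sqrt_of_sq_le
  rw [Pi.sub_apply, Real.norm_eq_abs, sq_abs]
  exact Finset.single_le_sum (f := fun i => (Real.exp (-p i / 2) - Real.exp (-q i / 2)) ^ 2)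
    (fun i _ => sq_nonneg _) (Finset.mem_univ i)

theorem integrable_sum_exp_neg (ν : Measure X) [IsFiniteMeasure ν] {P : X → Fin K → ℝ}
    (hP : Measurable P) (h0 : ∀ s i, 0 ≤ P s i) :
    Integrable (fun s => ∑ i, Real.exp (-P s i)) ν := by
  refine integrable_finsetSum _ fun i _ => Integrable.of_bound (C := 1) ?_ ?_
  · exact (Real.measurable_exp.comp (measurable_pi_iff.1 hP i).neg).aestronglyMeasurable
  · refine Filter.Eventually.of_forall fun s => ?_
    rw [Real.norm_eq_abs, Real.abs_exp, Real.exp_le_one_iff]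
    linarith [h0 s i]

theorem memLp_exp_neg_half (ν : Measure X) [IsFiniteMeasure ν] {P : X → Fin K → ℝ}
    (hP : Measurable P) (h0 : ∀ s i, 0 ≤ P s i) :
    MemLp (fun s i => Real.exp (-P s i / 2)) 2 ν := by
  refine MemLp.of_bound (C := 1) ?_ ?_
  · refine (measurable_pi_iff.2 fun i => ?_).aestronglyMeasurable
    exact Real.measurable_exp.comp ((measurable_pi_iff.1 hP i).neg.div_const 2)
  · refine Filter.Eventually.of_forall fun s => ?_
    rw [pi_norm_le_iff_of_nonneg zero_le_one]
    intro i
    rw [Real.norm_eq_abs, Real.abs_exp, Real.exp_le_one_iff]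
    linarith [h0 s i]

open Filter Topology in
/-- A decreasing sequence of nonempty midpoint-convex sets of nonnegative allocations, bounded in
`L¹`, admits a selection that converges almost everywhere. -/
theorem exists_seq_mem_tendsto_ae (ν : Measure X) [IsProbabilityMeasure ν]
    (C : ℕ → Set (X → Fin K → ℝ)) (hanti : Antitone C) (hne : ∀ n, (C n).Nonempty)
    (hmid : ∀ n, ∀ P ∈ C n, ∀ Q ∈ C n, (fun s i => (P s i + Q s i) / 2) ∈ C n)
    (hmeas : ∀ n, ∀ P ∈ C n, Measurable P) (hnn : ∀ n, ∀ P ∈ C n, ∀ s i, 0 ≤ P s i)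
    (B : Fin K → ℝ)
    (hint : ∀ n, ∀ P ∈ C n, ∀ i, Integrable (fun s => P s i) ν ∧ ∫ s, P s i ∂ν ≤ B i) :
    ∃ (Q : ℕ → X → Fin K → ℝ) (P : X → Fin K → ℝ), (∀ n, Q n ∈ C n) ∧ Measurable P ∧
      (∀ s i, 0 ≤ P s i) ∧
      ∀ᵐ s ∂ν, ∀ i, Tendsto (fun n => Q n s i) atTop (𝓝 (P s i)) := by
  set Φ : (X → Fin K → ℝ) → ℝ := fun P => ∫ s, ∑ i, Real.exp (-P s i) ∂ν with hΦ
  have hΦint : ∀ n, ∀ P ∈ C n, Integrable (fun s => ∑ i, Real.exp (-P s i)) ν :=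
    fun n P hP => integrable_sum_exp_neg ν (hmeas n P hP) (hnn n P hP)
  have hΦ0 : ∀ P, 0 ≤ Φ P := fun P =>
    integral_nonneg fun s => Finset.sum_nonneg fun i _ => (Real.exp_pos _).le
  have hΦK : ∀ n, ∀ P ∈ C n, Φ P ≤ K := fun n P hP => by
    have : Φ P ≤ ∫ _ : X, (K : ℝ) ∂ν := by
      refine integral_mono (hΦint n P hP) (integrable_const _) fun s => ?_
      refine (Finset.sum_le_card_nsmul _ _ 1 fun i _ => ?_).trans (by simp)
      rw [Real.exp_le_one_iff]
      linarith [hnn n P hP s i]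
    simpa using this
  set w : ℕ → ℝ := fun n => sInf (Φ '' C n) with hw
  have hbdd : ∀ n, BddBelow (Φ '' C n) := fun n =>
    ⟨0, by rintro _ ⟨P, _, rfl⟩; exact hΦ0 P⟩
  have hwle : ∀ n, ∀ P ∈ C n, w n ≤ Φ P := fun n P hP =>
    csInf_le (hbdd n) (Set.mem_image_of_mem _ hP)
  have hwmono : Monotone w := fun m n hmn =>
    csInf_le_csInf (hbdd m) ((hne n).image _) (Set.image_mono (hanti hmn))
  have hwbdd : BddAbove (Set.range w) := by
    refine ⟨K, ?_⟩
    rintro _ ⟨n, rfl⟩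
    obtain ⟨P, hP⟩ := hne n
    exact (hwle n P hP).trans (hΦK n P hP)
  have hwlim := tendsto_atTop_ciSup hwmono hwbdd
  set W := ⨆ n, w n
  have hex : ∀ n : ℕ, ∃ P ∈ C n, Φ P < w n + 1 / ((n : ℝ) + 1) := fun n => by
    obtain ⟨_, ⟨P, hP, rfl⟩, hlt⟩ := exists_lt_of_csInf_lt ((hne n).image Φ)
      (show sInf (Φ '' C n) < w n + 1 / ((n : ℝ) + 1) by
        have : 0 < 1 / ((n : ℝ) + 1) := by positivity
        linarith)
    exact ⟨P, hP, hlt⟩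
  choose Q hQC hQΦ using hex
  have hQm : ∀ n, Measurable (Q n) := fun n => hmeas n _ (hQC n)
  have hQ0 : ∀ n s i, 0 ≤ Q n s i := fun n => hnn n _ (hQC n)
  set f : ℕ → X → Fin K → ℝ := fun n s i => Real.exp (-Q n s i / 2) with hf
  have hfLp : ∀ n, MemLp (f n) 2 ν := fun n => memLp_exp_neg_half ν (hQm n) (hQ0 n)
  -- Both `Q n` and `Q m` nearly minimize `Φ`, while their midpoint lies in `C k` and so has `Φ` at
  -- least `w k`. The convexity gap is thus small, and the bound tends to 0 because `w k` tends to
  -- `W`.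
  have hgap : ∀ n m k, k ≤ n → k ≤ m →
      ∫ s, ‖f n s - f m s‖ ^ 2 ∂ν ≤ 2 * (W + 1 / ((k : ℝ) + 1)) - 2 * w k := by
    intro n m k hn hm
    have hmem := hmid k _ (hanti hn (hQC n)) _ (hanti hm (hQC m))
    have h1 : ∫ s, ‖f n s - f m s‖ ^ 2 ∂ν ≤ Φ (Q n) + Φ (Q m)
        - 2 * Φ (fun s i => (Q n s i + Q m s i) / 2) := by
      have i1 := hΦint n _ (hQC n)
      have i2 := hΦint m _ (hQC m)
      have i3 := hΦint k _ hmem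
      simp only [hΦ]
      rw [← integral_add i1 i2, ← integral_const_mul]
      refine le_of_le_of_eq ?_ (integral_sub (i1.add i2) (i3.const_mul 2))
      refine integral_mono (((hfLp n).sub (hfLp m)).integrable_norm_pow (by norm_num))
        ((i1.add i2).sub (i3.const_mul 2)) fun s => ?_
      exact exp_midpoint_gap (Q n s) (Q m s)
    have hstep : ∀ l, k ≤ l → Φ (Q l) ≤ W + 1 / ((k : ℝ) + 1) := fun l hl => by
      have := hQΦ l
      have h2 : w l ≤ W := le_ciSup hwbdd l
      have h3 : 1 / ((l : ℝ) + 1) ≤ 1 / ((k : ℝ) + 1) := Nat.one_div_le_one_div hl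
      linarith
    linarith [hstep n hn, hstep m hm, hwle k _ hmem]
  have hcauchy : CauchySeq fun n => (hfLp n).toLp (f n) := by
    refine cauchySeq_of_le_tendsto_0
      (fun k : ℕ => Real.sqrt (2 * (W + 1 / ((k : ℝ) + 1)) - 2 * w k)) (fun n m k hn hm => ?_) ?_
    · rw [dist_toLp_eq_sqrt]
      exact Real.sqrt_le_sqrt (hgap n m k hn hm)
    · have h1 : Tendsto (fun k : ℕ => 2 * (W + 1 / ((k : ℝ) + 1)) - 2 * w k) atTop
          (𝓝 (2 * (W + 0) - 2 * W)) :=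
        ((tendsto_const_nhds.add tendsto_one_div_add_atTop_nhds_zero_nat).const_mul 2).sub
          (hwlim.const_mul 2)
      simpa using h1.sqrt
  obtain ⟨F, hF⟩ := cauchySeq_tendsto_of_complete hcauchy
  obtain ⟨ns, hns, hae⟩ := (tendstoInMeasure_of_tendsto_Lp hF).exists_seq_tendsto_ae
  have hcoe : ∀ᵐ s ∂ν, ∀ n, (hfLp n).toLp (f n) s = f n s :=
    ae_all_iff.2 fun n => (hfLp n).coeFn_toLp
  have hfin : ∀ᵐ s ∂ν, ∀ i, liminf (fun n => ENNReal.ofReal (Q (ns n) s i)) atTop < ⊤ :=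
    ae_all_iff.2 fun i => ae_liminf_ofReal_lt_top
      (fun n => measurable_pi_iff.1 (hQm (ns n)) i) (fun n => (hint _ _ (hQC (ns n)) i).1)
      (fun n => Eventually.of_forall fun s => hQ0 _ s i)
      (fun n => (hint _ _ (hQC (ns n)) i).2)
  have hFm : Measurable F := (Lp.stronglyMeasurable F).measurable
  -- The limit power inverts `exp (-x / 2)`; truncation at 0 makes it nonnegative everywhere,
  -- including on the exceptional null set.
  refine ⟨fun n => Q (ns n), fun s i => max 0 (-2 * Real.log (F s i)),
    fun n => hanti hns.le_apply (hQC _), ?_, fun s i => le_max_left _ _, ?_⟩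
  · refine measurable_pi_iff.2 fun i => measurable_const.max ?_
    exact (Real.measurable_log.comp (measurable_pi_iff.1 hFm i)).const_mul _
  · filter_upwards [hae, hcoe, hfin] with s hs hcs hfs i
    simp only [hcs] at hs
    have hsi : Tendsto (fun n => Real.exp (-Q (ns n) s i / 2)) atTop (𝓝 (F s i)) :=
      (tendsto_pi_nhds.1 hs) i
    -- A zero limit would mean that the powers tend to infinity, against the finiteness of their
    -- liminf.
    have hne0 : F s i ≠ 0 := fun h0 => by
      rw [h0, Real.tendsto_exp_comp_nhds_zero] at hsi
      have h1 : Tendsto (fun n => Q (ns n) s i) atTop atTop := by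
        have := hsi.const_mul_atBot_of_neg (show (-2 : ℝ) < 0 by norm_num)
        refine this.congr fun n => by ring
      have h2 := (ENNReal.tendsto_ofReal_atTop.comp h1).liminf_eq
      exact (hfs i).ne h2
    have hlog : Tendsto (fun n => Q (ns n) s i) atTop (𝓝 (-2 * Real.log (F s i))) := by
      refine ((hsi.log hne0).const_mul (-2)).congr fun n => ?_
      rw [Real.log_exp]; ring
    rwa [max_eq_right (ge_of_tendsto' hlog fun n => hQ0 _ s i)]

end Compactness

/-! ### Feasible allocations and existence of a SIC maximizer -/

section Optimization

variable {X : Type*} [MeasurableSpace X] {K : ℕ}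

/-- The power allocations, as functions on an arbitrary measure space of fading states, that
satisfy the average power constraints and the average interference constraint. -/
def powerFeasible (ν : Measure X) (g : X → Fin K → ℝ) (Pav : Fin K → ℝ) (Iav : ℝ) :
    Set (X → Fin K → ℝ) :=
  {P | Measurable P ∧ (∀ s i, 0 ≤ P s i) ∧
    (∀ i, Integrable (fun s => P s i) ν ∧ ∫ s, P s i ∂ν ≤ Pav i) ∧
    (Integrable (fun s => ∑ i, g s i * P s i) ν ∧ ∫ s, ∑ i, g s i * P s i ∂ν ≤ Iav)}

variable {ν : Measure X} {g h : X → Fin K → ℝ} {Pav : Fin K → ℝ} {Iav N : ℝ}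
  {P Q : X → Fin K → ℝ}

theorem zero_mem_powerFeasible (hPav : ∀ i, 0 ≤ Pav i) (hIav : 0 ≤ Iav) :
    (fun _ _ => 0) ∈ powerFeasible ν g Pav Iav :=
  ⟨measurable_const, fun _ _ => le_rfl, fun i => ⟨integrable_zero _ _ _, by simpa using hPav i⟩,
    by simp, by simpa using hIav⟩

theorem midpoint_mem_powerFeasible (hP : P ∈ powerFeasible ν g Pav Iav)
    (hQ : Q ∈ powerFeasible ν g Pav Iav) :
    (fun s i => (P s i + Q s i) / 2) ∈ powerFeasible ν g Pav Iav := by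
  obtain ⟨Pm, P0, Pp, PI, PIle⟩ := hP
  obtain ⟨Qm, Q0, Qp, QI, QIle⟩ := hQ
  refine ⟨?_, fun s i => ?_, fun i => ⟨((Pp i).1.add (Qp i).1).div_const 2, ?_⟩, ?_, ?_⟩
  · exact measurable_pi_iff.2 fun i =>
      ((measurable_pi_iff.1 Pm i).add (measurable_pi_iff.1 Qm i)).div_const 2
  · linarith [P0 s i, Q0 s i]
  · rw [integral_div, integral_add (Pp i).1 (Qp i).1]
    linarith [(Pp i).2, (Qp i).2]
  · simp only [weightedPower_midpoint]
    exact (PI.add QI).div_const 2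
  · simp only [weightedPower_midpoint]
    rw [integral_div, integral_add PI QI]
    linarith

open Filter Topology in
theorem mem_powerFeasible_of_tendsto_ae (hgm : Measurable g) (hg : ∀ᵐ s ∂ν, ∀ i, 0 ≤ g s i)
    {Q : ℕ → X → Fin K → ℝ} (hQ : ∀ n, Q n ∈ powerFeasible ν g Pav Iav) (hPm : Measurable P)
    (hP0 : ∀ s i, 0 ≤ P s i)
    (hlim : ∀ᵐ s ∂ν, ∀ i, Tendsto (fun n => Q n s i) atTop (𝓝 (P s i))) :
    P ∈ powerFeasible ν g Pav Iav := by
  refine ⟨hPm, hP0, fun i => ?_, ?_⟩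
  · refine integrable_and_integral_le_of_tendsto_ae (fun n => ((hQ n).2.2.1 i).1)
      (fun n => Eventually.of_forall fun s => (hQ n).2.1 s i) (fun n => ((hQ n).2.2.1 i).2)
      tendsto_const_nhds (measurable_pi_iff.1 hPm i).aestronglyMeasurable ?_
    filter_upwards [hlim] with s hs using hs i
  · refine integrable_and_integral_le_of_tendsto_ae (fun n => (hQ n).2.2.2.1)
      (fun n => ?_) (fun n => (hQ n).2.2.2.2)
      tendsto_const_nhds ?_ ?_
    · filter_upwards [hg] with s hs
      exact weightedPower_nonneg hs ((hQ n).2.1 s)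
    · exact (Finset.measurable_fun_sum _ fun i _ =>
        (measurable_pi_iff.1 hgm i).mul (measurable_pi_iff.1 hPm i)).aestronglyMeasurable
    · filter_upwards [hlim] with s hs
      exact tendsto_finsetSum _ fun i _ => (hs i).const_mul _

theorem measurable_sumRateSIC (hhm : Measurable h) (hPm : Measurable P) :
    Measurable fun s => sumRateSIC N (h s) (P s) := by
  refine Real.measurable_log.comp (measurable_const.add (Finset.measurable_fun_sum _ fun i _ => ?_))
  exact ((measurable_pi_iff.1 hhm i).mul (measurable_pi_iff.1 hPm i)).div_const N

theorem measurable_sumRateNoSIC (hhm : Measurable h) (hPm : Measurable P) :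
    Measurable fun s => sumRateNoSIC N (h s) (P s) := by
  have hm : ∀ i, Measurable fun s => h s i * P s i := fun i =>
    (measurable_pi_iff.1 hhm i).mul (measurable_pi_iff.1 hPm i)
  refine Finset.measurable_fun_sum _ fun i _ => Real.measurable_log.comp
    (measurable_const.add ((hm i).div (measurable_const.add ?_)))
  exact Finset.measurable_fun_sum _ fun j _ => hm j

theorem integrable_sumRateSIC (hN : 0 < N) (hhm : Measurable h)
    (hh : ∀ᵐ s ∂ν, ∀ i, 0 ≤ h s i) (hlog : ∀ i, Integrable (fun s => Real.log (1 + h s i)) ν)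
    (hP : P ∈ powerFeasible ν g Pav Iav) :
    Integrable (fun s => sumRateSIC N (h s) (P s)) ν := by
  have hdom : Integrable (fun s => ∑ i, (Real.log (1 + h s i) + P s i / N)) ν :=
    integrable_finsetSum _ fun i _ => (hlog i).add ((hP.2.2.1 i).1.div_const N)
  refine hdom.mono' (measurable_sumRateSIC hhm hP.1).aestronglyMeasurable ?_
  filter_upwards [hh] with s hs
  rw [Real.norm_eq_abs, abs_of_nonneg (sumRateSIC_nonneg hN hs (hP.2.1 s))]
  refine (sumRateSIC_le_sum hN hs (hP.2.1 s)).trans (Finset.sum_le_sum fun i _ => ?_)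
  have h0 : 0 ≤ P s i / N := div_nonneg (hP.2.1 s i) hN.le
  have := Real.log_le_sub_one_of_pos (show 0 < 1 + P s i / N by positivity)
  linarith

theorem integrable_sumRateNoSIC (hN : 0 < N) (hhm : Measurable h)
    (hh : ∀ᵐ s ∂ν, ∀ i, 0 ≤ h s i) (hlog : ∀ i, Integrable (fun s => Real.log (1 + h s i)) ν)
    (hP : P ∈ powerFeasible ν g Pav Iav) :
    Integrable (fun s => sumRateNoSIC N (h s) (P s)) ν := by
  refine (integrable_sumRateSIC hN hhm hh hlog hP).mono'
    (measurable_sumRateNoSIC hhm hP.1).aestronglyMeasurable ?_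
  filter_upwards [hh] with s hs
  rw [Real.norm_eq_abs, abs_of_nonneg (sumRateNoSIC_nonneg hN hs (hP.2.1 s))]
  exact sumRateNoSIC_le_sumRateSIC hN hs (hP.2.1 s)

theorem integral_sumRateSIC_le (hN : 0 < N) (hhm : Measurable h)
    (hh : ∀ᵐ s ∂ν, ∀ i, 0 ≤ h s i) (hlog : ∀ i, Integrable (fun s => Real.log (1 + h s i)) ν)
    (hP : P ∈ powerFeasible ν g Pav Iav) :
    ∫ s, sumRateSIC N (h s) (P s) ∂ν ≤ ∑ i, (∫ s, Real.log (1 + h s i) ∂ν + Pav i / N) := by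
  have hi : ∀ i, Integrable (fun s => Real.log (1 + h s i) + P s i / N) ν :=
    fun i => (hlog i).add ((hP.2.2.1 i).1.div_const N)
  calc ∫ s, sumRateSIC N (h s) (P s) ∂ν
      ≤ ∫ s, ∑ i, (Real.log (1 + h s i) + P s i / N) ∂ν := by
        refine integral_mono_ae (integrable_sumRateSIC hN hhm hh hlog hP)
          (integrable_finsetSum _ fun i _ => hi i) ?_
        filter_upwards [hh] with s hs
        refine (sumRateSIC_le_sum hN hs (hP.2.1 s)).trans (Finset.sum_le_sum fun i _ => ?_)
        have h0 : 0 ≤ P s i / N := div_nonneg (hP.2.1 s i) hN.le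
        have := Real.log_le_sub_one_of_pos (show 0 < 1 + P s i / N by positivity)
        linarith
    _ = ∑ i, (∫ s, Real.log (1 + h s i) ∂ν + (∫ s, P s i ∂ν) / N) := by
        rw [integral_finsetSum _ fun i _ => hi i]
        refine Finset.sum_congr rfl fun i _ => ?_
        rw [integral_add (hlog i) ((hP.2.2.1 i).1.div_const N), integral_div]
    _ ≤ _ := by
        gcongr with i
        exact (hP.2.2.1 i).2

theorem integral_sumRateSIC_midpoint (hN : 0 < N) (hhm : Measurable h)
    (hh : ∀ᵐ s ∂ν, ∀ i, 0 ≤ h s i) (hlog : ∀ i, Integrable (fun s => Real.log (1 + h s i)) ν)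
    (hP : P ∈ powerFeasible ν g Pav Iav) (hQ : Q ∈ powerFeasible ν g Pav Iav) :
    (∫ s, sumRateSIC N (h s) (P s) ∂ν + ∫ s, sumRateSIC N (h s) (Q s) ∂ν) / 2 ≤
      ∫ s, sumRateSIC N (h s) (fun i => (P s i + Q s i) / 2) ∂ν := by
  have hPi := integrable_sumRateSIC hN hhm hh hlog hP
  have hQi := integrable_sumRateSIC hN hhm hh hlog hQ
  rw [← integral_add hPi hQi, ← integral_div]
  refine integral_mono_ae ((hPi.add hQi).div_const 2)
    (integrable_sumRateSIC hN hhm hh hlog (midpoint_mem_powerFeasible hP hQ)) ?_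
  filter_upwards [hh] with s hs
  exact sumRateSIC_midpoint hN hs (hP.2.1 s) (hQ.2.1 s)

open Filter Topology in
/-- The ergodic sum-rate with interference cancellation is upper semicontinuous along sequences of
feasible allocations that converge almost everywhere. -/
theorem le_integral_sumRateSIC_of_tendsto_ae [IsProbabilityMeasure ν] (hN : 0 < N)
    (hhm : Measurable h) (hh : ∀ᵐ s ∂ν, ∀ i, 0 ≤ h s i)
    (hlog : ∀ i, Integrable (fun s => Real.log (1 + h s i)) ν) (hPav : ∀ i, 0 ≤ Pav i)
    {Q : ℕ → X → Fin K → ℝ} (hQ : ∀ n, Q n ∈ powerFeasible ν g Pav Iav)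
    (hP : P ∈ powerFeasible ν g Pav Iav)
    (hlim : ∀ᵐ s ∂ν, ∀ i, Tendsto (fun n => Q n s i) atTop (𝓝 (P s i)))
    {v : ℕ → ℝ} {V : ℝ} (hv : ∀ n, v n ≤ ∫ s, sumRateSIC N (h s) (Q n s) ∂ν)
    (hV : Tendsto v atTop (𝓝 V)) : V ≤ ∫ s, sumRateSIC N (h s) (P s) ∂ν := by
  have hS : 0 ≤ ∑ i, Pav i := Finset.sum_nonneg fun i _ => hPav i
  refine le_of_forall_pos_le_add fun δ hδ => ?_
  -- The average powers are bounded by `Pav`, so the linear term of slope `ε` contributes at most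
  -- `δ`; the `+ 1` avoids division by zero.
  set ε := δ / (∑ i, Pav i + 1) with hε
  have hε0 : 0 < ε := by positivity
  have hεS : ε * ∑ i, Pav i ≤ δ := by
    rw [hε, div_mul_eq_mul_div, div_le_iff₀ (by positivity)]
    nlinarith
  set D := ε * N + |Real.log (ε * N)|
  -- `G R` is an integrable majorant of the rate minus the rate, hence nonnegative: Fatou's lemma
  -- applied to it gives an upper bound for limits of the rate.
  set G : (X → Fin K → ℝ) → X → ℝ := fun R s =>
    ∑ i, (Real.log (1 + h s i) + (ε * R s i + D)) - sumRateSIC N (h s) (R s) with hG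
  have hiS : ∀ R ∈ powerFeasible ν g Pav Iav, ∀ i,
      Integrable (fun s => Real.log (1 + h s i) + (ε * R s i + D)) ν := fun R hR i =>
    (hlog i).add (((hR.2.2.1 i).1.const_mul ε).add (integrable_const D))
  have hGi : ∀ R ∈ powerFeasible ν g Pav Iav, Integrable (G R) ν := fun R hR =>
    (integrable_finsetSum _ fun i _ => hiS R hR i).sub (integrable_sumRateSIC hN hhm hh hlog hR)
  have hG0 : ∀ R ∈ powerFeasible ν g Pav Iav, 0 ≤ᵐ[ν] G R := fun R hR => by
    filter_upwards [hh] with s hs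
    refine sub_nonneg.2 ((sumRateSIC_le_sum hN hs (hR.2.1 s)).trans
      (Finset.sum_le_sum fun i _ => ?_))
    have := log_one_add_div_le hN hε0 (hR.2.1 s i)
    linarith
  have hGint : ∀ R ∈ powerFeasible ν g Pav Iav, ∫ s, G R s ∂ν =
      ∑ i, ∫ s, Real.log (1 + h s i) ∂ν + ε * ∑ i, ∫ s, R s i ∂ν + K * D
        - ∫ s, sumRateSIC N (h s) (R s) ∂ν := fun R hR => by
    simp only [hG]
    rw [integral_sub (integrable_finsetSum _ fun i _ => hiS R hR i)
      (integrable_sumRateSIC hN hhm hh hlog hR), integral_finsetSum _ fun i _ => hiS R hR i]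
    congr 1
    have : ∀ i, ∫ s, (Real.log (1 + h s i) + (ε * R s i + D)) ∂ν =
        ∫ s, Real.log (1 + h s i) ∂ν + (ε * ∫ s, R s i ∂ν + D) := fun i => by
      have hi := (hR.2.2.1 i).1.const_mul ε
      have hiD : Integrable (fun s => ε * R s i + D) ν := hi.add (integrable_const D)
      rw [integral_add (hlog i) hiD, integral_add hi (integrable_const D), integral_const_mul]
      simp
    simp only [this, Finset.sum_add_distrib, Finset.mul_sum]
    simp [add_assoc]
  have hlimG : ∀ᵐ s ∂ν, Tendsto (fun n => G (Q n) s) atTop (𝓝 (G P s)) := by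
    filter_upwards [hlim, hh] with s hs hhs
    refine Tendsto.sub (tendsto_finsetSum _ fun i _ =>
      tendsto_const_nhds.add (((hs i).const_mul ε).add tendsto_const_nhds)) ?_
    simp only [sumRateSIC_eq_log]
    have h0 := weightedPower_nonneg hhs (hP.2.1 s)
    refine Tendsto.log (tendsto_const_nhds.add ((tendsto_finsetSum _ fun i _ =>
      (hs i).const_mul _).div_const N)) (by positivity)
  have key := (integrable_and_integral_le_of_tendsto_ae
    (c := fun n => ∑ i, ∫ s, Real.log (1 + h s i) ∂ν + ε * ∑ i, Pav i + K * D - v n)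
    (fun n => hGi _ (hQ n)) (fun n => hG0 _ (hQ n))
    (fun n => ?_) (hV.const_sub _) (hGi P hP).1 hlimG).2
  · rw [hGint P hP] at key
    have : 0 ≤ ε * ∑ i, ∫ s, P s i ∂ν := mul_nonneg hε0.le
      (Finset.sum_nonneg fun i _ => integral_nonneg fun s => hP.2.1 s i)
    linarith
  · rw [hGint _ (hQ n)]
    have : ε * ∑ i, ∫ s, Q n s i ∂ν ≤ ε * ∑ i, Pav i :=
      mul_le_mul_of_nonneg_left (Finset.sum_le_sum fun i _ => ((hQ n).2.2.1 i).2) hε0.le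
    linarith [hv n]

open Filter Topology in
theorem exists_isMaxOn_integral_sumRateSIC [IsProbabilityMeasure ν] (hN : 0 < N)
    (hhm : Measurable h) (hh : ∀ᵐ s ∂ν, ∀ i, 0 ≤ h s i)
    (hlog : ∀ i, Integrable (fun s => Real.log (1 + h s i)) ν)
    (hgm : Measurable g) (hg : ∀ᵐ s ∂ν, ∀ i, 0 ≤ g s i)
    (hPav : ∀ i, 0 ≤ Pav i) (hIav : 0 ≤ Iav) :
    ∃ P ∈ powerFeasible ν g Pav Iav,
      IsMaxOn (fun P => ∫ s, sumRateSIC N (h s) (P s) ∂ν) (powerFeasible ν g Pav Iav) P := by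
  set J : (X → Fin K → ℝ) → ℝ := fun P => ∫ s, sumRateSIC N (h s) (P s) ∂ν with hJ
  have hne : (J '' powerFeasible ν g Pav Iav).Nonempty :=
    ⟨_, Set.mem_image_of_mem J (zero_mem_powerFeasible hPav hIav)⟩
  have hbdd : BddAbove (J '' powerFeasible ν g Pav Iav) :=
    ⟨_, by rintro _ ⟨P, hP, rfl⟩; exact integral_sumRateSIC_le hN hhm hh hlog hP⟩
  set V := sSup (J '' powerFeasible ν g Pav Iav)
  -- Superlevel sets approaching the supremum: an almost everywhere limit of a selection from them
  -- attains it by upper semicontinuity.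
  set C : ℕ → Set (X → Fin K → ℝ) := fun n =>
    {P | P ∈ powerFeasible ν g Pav Iav ∧ V - 1 / ((n : ℝ) + 1) ≤ J P} with hC
  obtain ⟨Q, P, hQ, hPm, hP0, hlim⟩ := exists_seq_mem_tendsto_ae ν C
    (fun m n hmn P hP => ⟨hP.1, le_trans (by
      have : 1 / ((n : ℝ) + 1) ≤ 1 / ((m : ℝ) + 1) := Nat.one_div_le_one_div hmn
      linarith) hP.2⟩)
    (fun n => by
      obtain ⟨_, ⟨P, hP, rfl⟩, hlt⟩ := exists_lt_of_lt_csSup hne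
        (show V - 1 / ((n : ℝ) + 1) < V by
          have : 0 < 1 / ((n : ℝ) + 1) := by positivity
          linarith)
      exact ⟨P, hP, hlt.le⟩)
    (fun n P hP Q hQ => ⟨midpoint_mem_powerFeasible hP.1 hQ.1, le_trans (by linarith [hP.2, hQ.2])
      (integral_sumRateSIC_midpoint hN hhm hh hlog hP.1 hQ.1)⟩)
    (fun n P hP => hP.1.1) (fun n P hP => hP.1.2.1) Pav (fun n P hP => hP.1.2.2.1)
  have hP := mem_powerFeasible_of_tendsto_ae hgm hg (fun n => (hQ n).1) hPm hP0 hlim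
  refine ⟨P, hP, isMaxOn_iff.2 fun R hR => (le_csSup hbdd (Set.mem_image_of_mem J hR)).trans ?_⟩
  refine le_integral_sumRateSIC_of_tendsto_ae hN hhm hh hlog hPav (fun n => (hQ n).1) hP hlim
    (fun n => (hQ n).2) ?_
  simpa using (tendsto_one_div_add_atTop_nhds_zero_nat (𝕜 := ℝ)).const_sub V

end Optimization

/-- Finitely many square-integrable functions without almost everywhere linear relations have a
linear combination with prescribed moments against each of them. -/
theorem exists_integral_mul_linearCombination_eq {X ι : Type*} [MeasurableSpace X] [Fintype ι]
    {ρ : Measure X} {f : ι → X → ℝ} (hf : ∀ k, MemLp (f k) 2 ρ)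
    (hind : ∀ c : ι → ℝ, (∀ᵐ s ∂ρ, ∑ k, c k * f k s = 0) → c = 0) (b : ι → ℝ) :
    ∃ c : ι → ℝ, ∀ k, ∫ s, f k s * ∑ l, c l * f l s ∂ρ = b k := by
  classical
  have hint : ∀ k l, Integrable (fun s => f k s * f l s) ρ := fun k l =>
    (hf k).integrable_mul (hf l)
  have hrow : ∀ (c : ι → ℝ) k, ∫ s, f k s * ∑ l, c l * f l s ∂ρ =
      ∑ l, (∫ s, f k s * f l s ∂ρ) * c l := fun c k => by
    simp only [Finset.mul_sum]
    rw [integral_finsetSum _ fun l _ => ((hint k l).const_mul (c l)).congr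
      (Filter.Eventually.of_forall fun s => by ring)]
    refine Finset.sum_congr rfl fun l _ => ?_
    rw [← integral_mul_const]
    exact integral_congr_ae (Filter.Eventually.of_forall fun s => by ring)
  -- The Gram matrix of `f`. A kernel vector `c` satisfies `∫ (∑ c k * f k) ^ 2 = 0`, so
  -- independence makes the matrix injective, hence surjective.
  set T : (ι → ℝ) →ₗ[ℝ] (ι → ℝ) :=
    Matrix.mulVecLin (Matrix.of fun k l => ∫ s, f k s * f l s ∂ρ) with hT
  have hTapp : ∀ c k, T c k = ∫ s, f k s * ∑ l, c l * f l s ∂ρ := fun c k => by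
    rw [hrow]; rfl
  have hinj : Function.Injective T := by
    rw [injective_iff_map_eq_zero]
    intro c hc
    apply hind
    have hLp : MemLp (fun s => ∑ k, c k * f k s) 2 ρ :=
      memLp_finsetSum _ fun k _ => (hf k).const_mul (c k)
    have hzero : ∫ s, (∑ k, c k * f k s) * ∑ l, c l * f l s ∂ρ = 0 := by
      have hi : ∀ k, Integrable (fun s => c k * f k s * ∑ l, c l * f l s) ρ := fun k =>
        ((hf k).const_mul (c k)).integrable_mul hLp
      simp only [Finset.sum_mul]
      rw [integral_finsetSum _ fun k _ => hi k]
      refine Finset.sum_eq_zero fun k _ => ?_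
      simp only [mul_assoc]
      rw [integral_const_mul, ← hTapp, hc]
      simp
    rw [integral_eq_zero_iff_of_nonneg (fun s => mul_self_nonneg _)
      (hLp.integrable_mul hLp)] at hzero
    filter_upwards [hzero] with s hs
    exact mul_self_eq_zero.1 hs
  obtain ⟨c, hc⟩ := (LinearMap.injective_iff_surjective.1 hinj) b
  exact ⟨c, fun k => by rw [← hTapp, hc]⟩

/-! ### Exchange of power between two users, and uniqueness -/

section Optimality

variable {X : Type*} [MeasurableSpace X] {K : ℕ} {ν : Measure X} {g h : X → Fin K → ℝ}
  {Pav : Fin K → ℝ} {Iav N : ℝ} {P Q : X → Fin K → ℝ}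

theorem add_mem_powerFeasible (hP : P ∈ powerFeasible ν g Pav Iav) {E : X → Fin K → ℝ}
    (hEm : Measurable E) (h0 : ∀ s i, 0 ≤ P s i + E s i)
    (hE : ∀ i, Integrable (fun s => E s i) ν ∧ ∫ s, E s i ∂ν ≤ 0)
    (hI : Integrable (fun s => ∑ i, g s i * E s i) ν ∧ ∫ s, ∑ i, g s i * E s i ∂ν ≤ 0) :
    (fun s i => P s i + E s i) ∈ powerFeasible ν g Pav Iav := by
  obtain ⟨Pm, P0, Pp, PI, PIle⟩ := hP
  refine ⟨Pm.add hEm, h0, fun i => ⟨(Pp i).1.add (hE i).1, ?_⟩, ?_⟩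
  · rw [integral_add (Pp i).1 (hE i).1]
    linarith [(Pp i).2, (hE i).2]
  · simp only [mul_add, Finset.sum_add_distrib]
    refine ⟨PI.add hI.1, ?_⟩
    rw [integral_add PI hI.1]
    linarith [hI.2]

/-- The form in which maximality is contradicted: as the logarithm is strictly increasing, an
allocation that never lowers the received power cannot raise it on a set of positive measure. -/
theorem weightedPower_ae_eq_of_isMaxOn (hN : 0 < N) (hhm : Measurable h)
    (hh : ∀ᵐ s ∂ν, ∀ i, 0 ≤ h s i) (hlog : ∀ i, Integrable (fun s => Real.log (1 + h s i)) ν)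
    (hP : P ∈ powerFeasible ν g Pav Iav)
    (hmax : IsMaxOn (fun P => ∫ s, sumRateSIC N (h s) (P s) ∂ν) (powerFeasible ν g Pav Iav) P)
    (hQ : Q ∈ powerFeasible ν g Pav Iav)
    (hle : ∀ᵐ s ∂ν, ∑ i, h s i * P s i ≤ ∑ i, h s i * Q s i) :
    ∀ᵐ s ∂ν, ∑ i, h s i * P s i = ∑ i, h s i * Q s i := by
  have hPi := integrable_sumRateSIC hN hhm hh hlog hP
  have hQi := integrable_sumRateSIC hN hhm hh hlog hQ
  have hae : (fun s => sumRateSIC N (h s) (P s)) ≤ᵐ[ν] fun s => sumRateSIC N (h s) (Q s) := by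
    filter_upwards [hle, hh] with s hs hhs
    rcases hs.eq_or_lt with heq | hlt
    · rw [sumRateSIC_eq_log, sumRateSIC_eq_log, heq]
    · exact (sumRateSIC_lt hN (weightedPower_nonneg hhs (hP.2.1 s)) hlt).le
  have heq := (integral_eq_iff_of_ae_le hPi hQi hae).1
    (le_antisymm (integral_mono_ae hPi hQi hae) (isMaxOn_iff.1 hmax Q hQ))
  filter_upwards [hle, hh, heq] with s hs hhs hes
  refine hs.eq_or_lt.resolve_right fun hlt => ?_
  exact (sumRateSIC_lt hN (weightedPower_nonneg hhs (hP.2.1 s)) hlt).ne hes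

theorem sum_mul_ite_ite {K : ℕ} (a : Fin K → ℝ) {i j : Fin K} (hij : i ≠ j) (x y : ℝ) :
    ∑ k, a k * (if k = i then x else if k = j then y else 0) = a i * x + a j * y := by
  rw [Fintype.sum_eq_add i j hij (fun k hk => by simp [hk.1, hk.2])]
  simp [hij.symm]

/-- On a set of positive measure on which the gains are bounded and two users transmit with power
bounded below, power can be exchanged between the two users so that all average constraints are
preserved while the received power strictly increases. -/
theorem measure_eq_zero_of_both_active [IsProbabilityMeasure ν] (hN : 0 < N)
    (hhm : Measurable h) (hpos : ∀ᵐ s ∂ν, ∀ i, 0 < h s i)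
    (hlog : ∀ i, Integrable (fun s => Real.log (1 + h s i)) ν) (hgm : Measurable g)
    {i j : Fin K} (hij : i ≠ j)
    (hgen : ∀ c : Fin 3 → ℝ, c ≠ 0 →
      ∀ᵐ s ∂ν, c 0 * h s j + c 1 * h s i + c 2 * (g s i * h s j - g s j * h s i) ≠ 0)
    (hP : P ∈ powerFeasible ν g Pav Iav)
    (hmax : IsMaxOn (fun P => ∫ s, sumRateSIC N (h s) (P s) ∂ν) (powerFeasible ν g Pav Iav) P)
    {A : Set X} (hA : MeasurableSet A) {δ M : ℝ} (hδ : 0 < δ) (hM : 0 ≤ M)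
    (hAP : ∀ s ∈ A, δ ≤ P s i ∧ δ ≤ P s j)
    (hAM : ∀ s ∈ A, ∀ k, |h s k| ≤ M ∧ |g s k| ≤ M) : ν A = 0 := by
  by_contra hA0
  have hh : ∀ᵐ s ∂ν, ∀ k, 0 ≤ h s k := by
    filter_upwards [hpos] with s hs k using (hs k).le
  have mh : ∀ k, Measurable fun s => h s k := fun k => measurable_pi_iff.1 hhm k
  have mg : ∀ k, Measurable fun s => g s k := fun k => measurable_pi_iff.1 hgm k
  set f : Fin 3 → X → ℝ := ![fun s => h s j, fun s => h s i,
    fun s => g s i * h s j - g s j * h s i] with hf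
  have mf : ∀ k, Measurable (f k) := by
    intro k
    fin_cases k
    · exact mh j
    · exact mh i
    · exact ((mg i).mul (mh j)).sub ((mg j).mul (mh i))
  have hfM : ∀ k, ∀ s ∈ A, |f k s| ≤ M + 2 * M ^ 2 := by
    intro k s hs
    have hi := hAM s hs i
    have hj := hAM s hs j
    fin_cases k
    · change |h s j| ≤ _
      nlinarith [hj.1]
    · change |h s i| ≤ _
      nlinarith [hi.1]
    · change |g s i * h s j - g s j * h s i| ≤ _
      have h1 : |g s i * h s j| ≤ M * M := by rw [abs_mul]; gcongr; exacts [hi.2, hj.1]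
      have h2 : |g s j * h s i| ≤ M * M := by rw [abs_mul]; gcongr; exacts [hj.2, hi.1]
      have h3 := abs_sub (g s i * h s j) (g s j * h s i)
      nlinarith
  have hfLp : ∀ k, MemLp (f k) 2 (ν.restrict A) := fun k =>
    MemLp.of_bound (mf k).aestronglyMeasurable (M + 2 * M ^ 2)
      (ae_restrict_of_forall_mem hA (hfM k))
  have hind : ∀ c : Fin 3 → ℝ, (∀ᵐ s ∂ν.restrict A, ∑ k, c k * f k s = 0) → c = 0 := by
    intro c hc
    by_contra hc0
    have hfalse : ∀ᵐ s ∂ν.restrict A, False := by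
      filter_upwards [hc, ae_restrict_of_ae (hgen c hc0)] with s h1 h2
      apply h2
      rw [Fin.sum_univ_three] at h1
      exact h1
    rw [ae_iff] at hfalse
    simp at hfalse
    exact hA0 hfalse
  -- The moments are chosen so that the exchange below has zero mean: the first cancels the `+ 1`
  -- added for user `i`, the second leaves the average of user `j` unchanged, and the third cancels
  -- the interference `g i` caused by that `+ 1`.
  obtain ⟨c, hc⟩ := exists_integral_mul_linearCombination_eq hfLp hind
    ![-ν.real A, 0, -∫ s in A, g s i ∂ν]
  set d : X → ℝ := fun s => ∑ l, c l * f l s with hd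
  have md : Measurable d := Finset.measurable_fun_sum _ fun l _ => (mf l).const_mul _
  have c0 : ∫ s in A, h s j * d s ∂ν = -ν.real A := hc 0
  have c1 : ∫ s in A, h s i * d s ∂ν = 0 := hc 1
  have c2 : ∫ s in A, (g s i * h s j - g s j * h s i) * d s ∂ν = -∫ s in A, g s i ∂ν := hc 2
  have hdLp : MemLp d 2 (ν.restrict A) := memLp_finsetSum _ fun l _ => (hfLp l).const_mul (c l)
  have i0 : Integrable (fun s => h s j * d s) (ν.restrict A) := (hfLp 0).integrable_mul hdLp
  have i1 : Integrable (fun s => h s i * d s) (ν.restrict A) := (hfLp 1).integrable_mul hdLp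
  have i2 : Integrable (fun s => (g s i * h s j - g s j * h s i) * d s) (ν.restrict A) :=
    (hfLp 2).integrable_mul hdLp
  have ig : Integrable (fun s => g s i) (ν.restrict A) :=
    Integrable.of_bound (mg i).aestronglyMeasurable M
      (ae_restrict_of_forall_mem hA fun s hs => (hAM s hs i).2)
  -- On `A`, `R` bounds both components of the exchange in absolute value, and there both users have
  -- power at least `δ`; the step `t = δ / R` therefore keeps the powers nonnegative.
  set R : ℝ := M * (∑ l, |c l| * (M + 2 * M ^ 2)) + 1 with hR
  have hR0 : 0 < R := by positivity
  have hdR : ∀ k, ∀ s ∈ A, |h s k * d s| ≤ R - 1 := fun k s hs => by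
    rw [abs_mul, hR, add_sub_cancel_right]
    refine mul_le_mul (hAM s hs k).1 ?_ (abs_nonneg _) hM
    refine (Finset.abs_sum_le_sum_abs _ _).trans (Finset.sum_le_sum fun l _ => ?_)
    rw [abs_mul]
    exact mul_le_mul_of_nonneg_left (hfM l s hs) (abs_nonneg _)
  set t : ℝ := δ / R with ht
  have ht0 : 0 < t := by positivity
  have htR : t * R = δ := by rw [ht]; field_simp
  -- In the received power, `h i * (h j * d + 1) - h j * (h i * d) = h i`: the function `d` drops
  -- out and a positive gain remains.
  set e : X → Fin K → ℝ := fun s k =>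
    if k = i then h s j * d s + 1 else if k = j then -(h s i * d s) else 0 with he
  set E : X → Fin K → ℝ := fun s => A.indicator (fun s => t • e s) s with hE
  have hEapp : ∀ s k, E s k = A.indicator (fun s => t * e s k) s := fun s k => by
    by_cases hs : s ∈ A <;> simp [hE, hs]
  have hEsum : ∀ (a : X → Fin K → ℝ) s, ∑ k, a s k * E s k =
      A.indicator (fun s => t * (a s i * (h s j * d s + 1) - a s j * (h s i * d s))) s := by
    intro a s
    by_cases hs : s ∈ A
    · simp only [hEapp, Set.indicator_of_mem hs]
      have := sum_mul_ite_ite (a s) hij (h s j * d s + 1) (-(h s i * d s))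
      rw [mul_neg, ← sub_eq_add_neg] at this
      rw [← this, Finset.mul_sum]
      exact Finset.sum_congr rfl fun k _ => by simp only [he]; ring
    · simp only [hEapp, Set.indicator_of_notMem hs, mul_zero, Finset.sum_const_zero]
  have me : Measurable e := measurable_pi_iff.2 fun k => by
    by_cases hki : k = i
    · simpa [he, hki] using ((mh j).mul md).add_const 1
    · by_cases hkj : k = j
      · simp only [he, if_neg hki, if_pos hkj]
        exact ((mh i).mul md).neg
      · simp [he, hki, hkj]
  have mE : Measurable E := (me.const_smul t).indicator hA
  have hmem : (fun s k => P s k + E s k) ∈ powerFeasible ν g Pav Iav := by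
    refine add_mem_powerFeasible hP mE (fun s k => ?_) (fun k => ?_) ?_
    · rw [hEapp]
      by_cases hs : s ∈ A
      · rw [Set.indicator_of_mem hs]
        by_cases hki : k = i
        · subst hki
          simp only [he, if_true]
          nlinarith [(hAP s hs).1, neg_abs_le (h s j * d s), hdR j s hs]
        · by_cases hkj : k = j
          · subst hkj
            simp only [he, if_true, if_neg hki]
            nlinarith [(hAP s hs).2, le_abs_self (h s i * d s), hdR i s hs]
          · simpa [he, hki, hkj] using hP.2.1 s k
      · rw [Set.indicator_of_notMem hs, add_zero]
        exact hP.2.1 s k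
    · simp only [hEapp]
      rw [integrable_indicator_iff hA, integral_indicator hA, integral_const_mul]
      by_cases hki : k = i
      · simp only [he, if_pos hki]
        refine ⟨(i0.add (integrable_const 1)).const_mul t, ?_⟩
        rw [integral_add i0 (integrable_const 1), c0]
        simp [Measure.real]
      · by_cases hkj : k = j
        · simp only [he, if_neg hki, if_pos hkj]
          refine ⟨i1.neg.const_mul t, ?_⟩
          rw [integral_neg, c1]
          simp
        · simp [he, hki, hkj]
    · simp only [hEsum]
      rw [integrable_indicator_iff hA, integral_indicator hA, integral_const_mul]
      have hrw : ∀ s, g s i * (h s j * d s + 1) - g s j * (h s i * d s) =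
          (g s i * h s j - g s j * h s i) * d s + g s i := fun s => by ring
      simp only [hrw]
      refine ⟨(i2.add ig).const_mul t, ?_⟩
      rw [integral_add i2 ig, c2]
      simp
  have hgain : ∀ s, ∑ k, h s k * (P s k + E s k) =
      ∑ k, h s k * P s k + A.indicator (fun s => t * h s i) s := fun s => by
    simp only [mul_add, Finset.sum_add_distrib, hEsum]
    congr 2
    funext s
    ring
  have heq := weightedPower_ae_eq_of_isMaxOn hN hhm hh hlog hP hmax hmem (by
    filter_upwards [hh] with s hs
    rw [hgain]
    have : 0 ≤ A.indicator (fun s => t * h s i) s := by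
      by_cases hsA : s ∈ A
      · rw [Set.indicator_of_mem hsA]; exact mul_nonneg ht0.le (hs i)
      · rw [Set.indicator_of_notMem hsA]
    linarith)
  apply hA0
  rw [measure_eq_zero_iff_ae_notMem]
  filter_upwards [heq, hpos] with s hs hps hsA
  rw [hgain, Set.indicator_of_mem hsA] at hs
  nlinarith [mul_pos ht0 (hps i)]

theorem ae_at_most_one_active [IsProbabilityMeasure ν] (hN : 0 < N)
    (hhm : Measurable h) (hpos : ∀ᵐ s ∂ν, ∀ i, 0 < h s i)
    (hlog : ∀ i, Integrable (fun s => Real.log (1 + h s i)) ν) (hgm : Measurable g)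
    (hgen : ∀ i j, i ≠ j → ∀ c : Fin 3 → ℝ, c ≠ 0 →
      ∀ᵐ s ∂ν, c 0 * h s j + c 1 * h s i + c 2 * (g s i * h s j - g s j * h s i) ≠ 0)
    (hP : P ∈ powerFeasible ν g Pav Iav)
    (hmax : IsMaxOn (fun P => ∫ s, sumRateSIC N (h s) (P s) ∂ν)
      (powerFeasible ν g Pav Iav) P) :
    ∀ᵐ s ∂ν, ∀ i j, 0 < P s i → 0 < P s j → i = j := by
  rw [ae_all_iff]; intro i
  rw [ae_all_iff]; intro j
  by_cases hij : i = j
  · exact Filter.Eventually.of_forall fun _ _ _ => hij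
  -- These sets exhaust the states in which both users transmit, and on each of them the gains are
  -- bounded and the two powers are bounded below.
  set A : ℕ → Set X := fun n => {s | 1 / ((n : ℝ) + 1) ≤ P s i ∧ 1 / ((n : ℝ) + 1) ≤ P s j ∧
    ∀ k, |h s k| ≤ n ∧ |g s k| ≤ n} with hA
  have mP : ∀ k, Measurable fun s => P s k := fun k => measurable_pi_iff.1 hP.1 k
  have hAm : ∀ n, MeasurableSet (A n) := fun n => by
    refine (measurableSet_le measurable_const (mP i)).inter
      ((measurableSet_le measurable_const (mP j)).inter ?_)
    refine (MeasurableSet.iInter fun k =>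
      (measurableSet_le (measurable_pi_iff.1 hhm k).abs (measurable_const (a := (n : ℝ)))).inter
        (measurableSet_le (measurable_pi_iff.1 hgm k).abs (measurable_const (a := (n : ℝ))))).congr ?_
    ext s
    exact Set.mem_iInter
  have hA0 : ∀ n, ν (A n) = 0 := fun n =>
    measure_eq_zero_of_both_active hN hhm hpos hlog hgm hij (hgen i j hij) hP hmax (hAm n)
      (by positivity) (Nat.cast_nonneg n) (fun s hs => ⟨hs.1, hs.2.1⟩) (fun s hs => hs.2.2)
  have hU := measure_iUnion_null hA0
  rw [measure_eq_zero_iff_ae_notMem] at hU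
  filter_upwards [hU] with s hs hi hj
  refine absurd ?_ hs
  obtain ⟨a, ha⟩ := exists_nat_one_div_lt hi
  obtain ⟨b, hb⟩ := exists_nat_one_div_lt hj
  obtain ⟨m, hm⟩ := exists_nat_ge (∑ k, (|h s k| + |g s k|))
  have hk : ∀ k, |h s k| + |g s k| ≤ m := fun k =>
    (Finset.single_le_sum (f := fun k => |h s k| + |g s k|)
      (fun k _ => add_nonneg (abs_nonneg _) (abs_nonneg _)) (Finset.mem_univ k)).trans hm
  refine Set.mem_iUnion.2 ⟨max (max a b) m, ?_, ?_, fun k => ?_⟩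
  · exact (Nat.one_div_le_one_div ((le_max_left a b).trans (le_max_left _ m))).trans ha.le
  · exact (Nat.one_div_le_one_div ((le_max_right a b).trans (le_max_left _ m))).trans hb.le
  · have hmm : (m : ℝ) ≤ (max (max a b) m : ℕ) := by exact_mod_cast le_max_right _ m
    constructor <;> linarith [hk k, abs_nonneg (h s k), abs_nonneg (g s k)]

/-- Maximizers with interference cancellation are unique almost everywhere. -/
theorem ae_eq_of_isMaxOn [IsProbabilityMeasure ν] (hN : 0 < N)
    (hhm : Measurable h) (hpos : ∀ᵐ s ∂ν, ∀ i, 0 < h s i)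
    (hlog : ∀ i, Integrable (fun s => Real.log (1 + h s i)) ν) (hgm : Measurable g)
    (hgen : ∀ i j, i ≠ j → ∀ c : Fin 3 → ℝ, c ≠ 0 →
      ∀ᵐ s ∂ν, c 0 * h s j + c 1 * h s i + c 2 * (g s i * h s j - g s j * h s i) ≠ 0)
    (hP : P ∈ powerFeasible ν g Pav Iav)
    (hPmax : IsMaxOn (fun P => ∫ s, sumRateSIC N (h s) (P s) ∂ν) (powerFeasible ν g Pav Iav) P)
    (hQ : Q ∈ powerFeasible ν g Pav Iav)
    (hQmax : IsMaxOn (fun P => ∫ s, sumRateSIC N (h s) (P s) ∂ν)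
      (powerFeasible ν g Pav Iav) Q) :
    ∀ᵐ s ∂ν, P s = Q s := by
  have hh : ∀ᵐ s ∂ν, ∀ k, 0 ≤ h s k := by
    filter_upwards [hpos] with s hs k using (hs k).le
  have hR := midpoint_mem_powerFeasible hP hQ
  have hJ := integral_sumRateSIC_midpoint hN hhm hh hlog hP hQ
  have hPQ := isMaxOn_iff.1 hPmax Q hQ
  have hQP := isMaxOn_iff.1 hQmax P hP
  have hPR := isMaxOn_iff.1 hPmax _ hR
  -- The midpoint is also a maximizer. Its TDMA property is what forces `P` and `Q` to use the same
  -- user.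
  have hRmax : IsMaxOn (fun P => ∫ s, sumRateSIC N (h s) (P s) ∂ν) (powerFeasible ν g Pav Iav)
      (fun s i => (P s i + Q s i) / 2) := isMaxOn_iff.2 fun S hS => by
    have := isMaxOn_iff.1 hPmax S hS
    simp only at hPQ hQP this ⊢
    linarith
  have hPi := integrable_sumRateSIC hN hhm hh hlog hP
  have hQi := integrable_sumRateSIC hN hhm hh hlog hQ
  have hRi := integrable_sumRateSIC hN hhm hh hlog hR
  have heq : (fun s => (sumRateSIC N (h s) (P s) + sumRateSIC N (h s) (Q s)) / 2) =ᵐ[ν]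
      fun s => sumRateSIC N (h s) (fun i => (P s i + Q s i) / 2) := by
    refine (integral_eq_iff_of_ae_le ((hPi.add hQi).div_const 2) hRi ?_).1 ?_
    · filter_upwards [hh] with s hs
      exact sumRateSIC_midpoint hN hs (hP.2.1 s) (hQ.2.1 s)
    · refine ((integral_div _ _).trans (congrArg (· / 2) (integral_add hPi hQi))).trans ?_
      linarith
  filter_upwards [heq, hpos, ae_at_most_one_active hN hhm hpos hlog hgm hgen hR hRmax]
    with s hs hps hone
  have hS := weightedPower_eq_of_sumRateSIC_midpoint_eq hN (fun i => (hps i).le) (hP.2.1 s)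
    (hQ.2.1 s) hs
  -- At most one coordinate of `P s + Q s` is positive, so equal received power means `h s i * P s i
  -- = h s i * Q s i` for that user, and `h s i` cancels.
  by_cases hex : ∃ i, 0 < P s i + Q s i
  · obtain ⟨i, hi⟩ := hex
    have hz : ∀ k, k ≠ i → P s k = 0 ∧ Q s k = 0 := fun k hk => by
      by_contra hne
      have hPk := hP.2.1 s k
      have hQk := hQ.2.1 s k
      refine hk (hone k i ?_ (by linarith))
      by_contra hle
      exact hne ⟨by linarith, by linarith⟩
    rw [Fintype.sum_eq_single i fun k hk => by simp [(hz k hk).1],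
      Fintype.sum_eq_single i fun k hk => by simp [(hz k hk).2]] at hS
    funext k
    by_cases hk : k = i
    · subst hk; exact mul_left_cancel₀ (hps k).ne' hS
    · rw [(hz k hk).1, (hz k hk).2]
  · push Not at hex
    funext k
    linarith [hex k, hP.2.1 s k, hQ.2.1 s k]

end Optimality

/-! ### Equality of the maximizers of the two problems -/

section Equivalence

variable {X : Type*} [MeasurableSpace X] {K : ℕ} {ν : Measure X} {g h : X → Fin K → ℝ}
  {Pav : Fin K → ℝ} {Iav N : ℝ} {P : X → Fin K → ℝ}

/-- If some maximizer with interference cancellation has at most one active user, then the problems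
with and without interference cancellation have the same maximizers. -/
theorem isMaxOn_sumRateNoSIC_iff (hN : 0 < N) (hhm : Measurable h)
    (hh : ∀ᵐ s ∂ν, ∀ i, 0 ≤ h s i) (hlog : ∀ i, Integrable (fun s => Real.log (1 + h s i)) ν)
    {R : X → Fin K → ℝ} (hR : R ∈ powerFeasible ν g Pav Iav)
    (hRmax : IsMaxOn (fun P => ∫ s, sumRateSIC N (h s) (P s) ∂ν) (powerFeasible ν g Pav Iav) R)
    (hone : ∀ P ∈ powerFeasible ν g Pav Iav,
      IsMaxOn (fun P => ∫ s, sumRateSIC N (h s) (P s) ∂ν) (powerFeasible ν g Pav Iav) P →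
      ∀ᵐ s ∂ν, ∀ i j, 0 < P s i → 0 < P s j → i = j)
    (hP : P ∈ powerFeasible ν g Pav Iav) :
    IsMaxOn (fun P => ∫ s, sumRateNoSIC N (h s) (P s) ∂ν) (powerFeasible ν g Pav Iav) P ↔
      IsMaxOn (fun P => ∫ s, sumRateSIC N (h s) (P s) ∂ν) (powerFeasible ν g Pav Iav) P := by
  have hle : ∀ Q ∈ powerFeasible ν g Pav Iav, ∫ s, sumRateNoSIC N (h s) (Q s) ∂ν ≤
      ∫ s, sumRateSIC N (h s) (Q s) ∂ν := fun Q hQ => by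
    refine integral_mono_ae (integrable_sumRateNoSIC hN hhm hh hlog hQ)
      (integrable_sumRateSIC hN hhm hh hlog hQ) ?_
    filter_upwards [hh] with s hs
    exact sumRateNoSIC_le_sumRateSIC hN hs (hQ.2.1 s)
  have heq : ∀ Q ∈ powerFeasible ν g Pav Iav,
      IsMaxOn (fun P => ∫ s, sumRateSIC N (h s) (P s) ∂ν) (powerFeasible ν g Pav Iav) Q →
      ∫ s, sumRateNoSIC N (h s) (Q s) ∂ν = ∫ s, sumRateSIC N (h s) (Q s) ∂ν := fun Q hQ hQm => by
    refine integral_congr_ae ?_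
    filter_upwards [hone Q hQ hQm] with s hs
    exact sumRateNoSIC_eq_sumRateSIC (hQ.2.1 s) hs
  constructor
  -- The chain is SIC(Q) ≤ SIC(R) = NoSIC(R) ≤ NoSIC(P) ≤ SIC(P).
  · intro hPm
    refine isMaxOn_iff.2 fun Q hQ => ?_
    have h1 := isMaxOn_iff.1 hRmax Q hQ
    have h2 := isMaxOn_iff.1 hPm R hR
    linarith [heq R hR hRmax, hle P hP]
  · intro hPm
    refine isMaxOn_iff.2 fun Q hQ => ?_
    have h1 := isMaxOn_iff.1 hPm Q hQ
    linarith [heq P hP hPm, hle Q hQ]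

end Equivalence

/-! ### Almost sure absence of linear relations between the gains -/

section Genericity

variable {Ω : Type*} [MeasurableSpace Ω] {μ : Measure Ω}

/-- By independence the joint law is a product, and each section of the graph of `φ` is a single
point, which is null for the law of `V`; Fubini concludes. -/
theorem ae_ne_of_indepFun {β : Type*} [MeasurableSpace β] [IsFiniteMeasure μ] {V : Ω → ℝ}
    {Y : Ω → β} (hV : Measurable V) (hY : Measurable Y) (hind : IndepFun Y V μ)
    (hatom : ∀ x, μ.map V {x} = 0) {φ : β → ℝ} (hφ : Measurable φ) :
    ∀ᵐ ω ∂μ, V ω ≠ φ (Y ω) := by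
  have hS : MeasurableSet {z : β × ℝ | z.2 = φ z.1} :=
    measurableSet_eq_fun measurable_snd (hφ.comp measurable_fst)
  have hmap := (indepFun_iff_map_prod_eq_prod_map_map hY.aemeasurable hV.aemeasurable).1 hind
  have h0 : ((μ.map Y).prod (μ.map V)) {z : β × ℝ | z.2 = φ z.1} = 0 := by
    rw [Measure.measure_prod_null hS]
    exact Filter.Eventually.of_forall fun y => hatom (φ y)
  rw [← hmap, Measure.map_apply (hY.prodMk hV) hS, measure_eq_zero_iff_ae_notMem] at h0
  exact h0

theorem map_singleton_eq_zero_of_hasPDF {V : Ω → ℝ} (hpdf : HasPDF V μ volume) (x : ℝ) :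
    μ.map V {x} = 0 :=
  HasPDF.absolutelyContinuous (Real.volume_singleton)

/-- A vanishing combination determines one gain from others independent of it: `g i` from `h i`, `h
j`, `g j` if `c 2 ≠ 0` (as `h j ≠ 0` almost surely), otherwise `h j` from `h i` if `c 0 ≠ 0`. In the
remaining case it says `h i = 0`. -/
theorem ae_gain_combination_ne_zero [IsProbabilityMeasure μ] {K : ℕ} {h g : Fin K → Ω → ℝ}
    (h_meas : ∀ i, Measurable (h i)) (g_meas : ∀ i, Measurable (g i))
    (indep : iIndepFun (Sum.elim h g) μ)
    (h_pdf : ∀ i, HasPDF (h i) μ volume) (g_pdf : ∀ i, HasPDF (g i) μ volume)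
    {i j : Fin K} (hij : i ≠ j) {c : Fin 3 → ℝ} (hc : c ≠ 0) :
    ∀ᵐ ω ∂μ, c 0 * h j ω + c 1 * h i ω + c 2 * (g i ω * h j ω - g j ω * h i ω) ≠ 0 := by
  have m : ∀ k, Measurable (Sum.elim h g k) := fun k => by
    cases k
    · exact h_meas _
    · exact g_meas _
  have hne0 : ∀ k, ∀ᵐ ω ∂μ, h k ω ≠ 0 := fun k =>
    ae_ne_of_indepFun (h_meas k) (measurable_const (a := (0 : ℝ)))
      (indepFun_const_left (0 : ℝ) (h k)) (map_singleton_eq_zero_of_hasPDF (h_pdf k)) measurable_id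
  by_cases h2 : c 2 = 0
  · by_cases h0 : c 0 = 0
    · have h1 : c 1 ≠ 0 := fun h1 => hc (by
        funext k; fin_cases k <;> assumption)
      filter_upwards [hne0 i] with ω hω
      simp [h2, h0, h1, hω]
    · have hind : IndepFun (h i) (h j) μ :=
        indep.indepFun (show (Sum.inl i : Fin K ⊕ Fin K) ≠ Sum.inl j by simpa using hij)
      filter_upwards [ae_ne_of_indepFun (h_meas j) (h_meas i) hind
        (map_singleton_eq_zero_of_hasPDF (h_pdf j))
        (measurable_id.const_mul (-(c 1 / c 0)))] with ω hω hz
      apply hω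
      simp only [h2, id] at hz ⊢
      field_simp
      linarith
  · have hind := indep.indepFun_finset {Sum.inl i, Sum.inl j, Sum.inr j} {Sum.inr i}
      (by simp [hij]) m
    set a : ({Sum.inl i, Sum.inl j, Sum.inr j} : Finset (Fin K ⊕ Fin K)) := ⟨Sum.inl i, by simp⟩
    set b : ({Sum.inl i, Sum.inl j, Sum.inr j} : Finset (Fin K ⊕ Fin K)) := ⟨Sum.inl j, by simp⟩
    set e : ({Sum.inl i, Sum.inl j, Sum.inr j} : Finset (Fin K ⊕ Fin K)) := ⟨Sum.inr j, by simp⟩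
    have hind' := hind.comp measurable_id
      (measurable_pi_apply (⟨Sum.inr i, by simp⟩ : ({Sum.inr i} : Finset (Fin K ⊕ Fin K))))
    have hφ : Measurable fun y : ({Sum.inl i, Sum.inl j, Sum.inr j} : Finset (Fin K ⊕ Fin K)) → ℝ =>
        (c 2 * (y e * y a) - c 0 * y b - c 1 * y a) / (c 2 * y b) := by fun_prop
    filter_upwards [hne0 j, ae_ne_of_indepFun (g_meas i)
      (measurable_pi_iff.2 fun k :
        ({Sum.inl i, Sum.inl j, Sum.inr j} : Finset (Fin K ⊕ Fin K)) => m k) hind'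
      (map_singleton_eq_zero_of_hasPDF (g_pdf i)) hφ] with ω hj hω hz
    apply hω
    change g i ω = (c 2 * (g j ω * h i ω) - c 0 * h j ω - c 1 * h i ω) / (c 2 * h j ω)
    rw [eq_div_iff (mul_ne_zero h2 hj)]
    linarith

end Genericity

/-! ### Passage from the probability space to the law of the fading state -/

section Transfer

variable {Ω : Type*} [MeasurableSpace Ω] {K : ℕ} {μ : Measure Ω} {h g : Fin K → Ω → ℝ}
  {Pav : Fin K → ℝ} {Iav N : ℝ} {P : PowerAllocation K}

theorem measurable_fadingState (h_meas : ∀ i, Measurable (h i)) (g_meas : ∀ i, Measurable (g i)) :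
    Measurable (fadingState h g) :=
  (measurable_pi_iff.2 h_meas).prodMk (measurable_pi_iff.2 g_meas)

theorem feasibleSet_eq_powerFeasible (h_meas : ∀ i, Measurable (h i))
    (g_meas : ∀ i, Measurable (g i)) :
    feasibleSet μ h g Pav Iav =
      powerFeasible (μ.map (fadingState h g)) (fun s : FadingState K => s.2) Pav Iav := by
  have hX := measurable_fadingState h_meas g_meas
  ext P
  refine and_congr_right fun hP => and_congr_right fun _ => ?_
  have h1 : ∀ i, AEStronglyMeasurable (fun s => P s i) (μ.map (fadingState h g)) := fun i =>
    (measurable_pi_iff.1 hP i).aestronglyMeasurable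
  have h2 : AEStronglyMeasurable (fun s : FadingState K => ∑ i, s.2 i * P s i)
      (μ.map (fadingState h g)) :=
    (Finset.measurable_fun_sum _ fun i _ => ((measurable_pi_apply i).comp measurable_snd).mul
      (measurable_pi_iff.1 hP i)).aestronglyMeasurable
  simp only [integral_map hX.aemeasurable (h1 _), integral_map hX.aemeasurable h2,
    integrable_map_measure (h1 _) hX.aemeasurable, integrable_map_measure h2 hX.aemeasurable]
  rfl

theorem ergodicSumRateSIC_eq_integral_map (h_meas : ∀ i, Measurable (h i))
    (g_meas : ∀ i, Measurable (g i)) (hP : Measurable P) :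
    ergodicSumRateSIC μ h g N P =
      ∫ s : FadingState K, sumRateSIC N s.1 (P s) ∂μ.map (fadingState h g) :=
  (integral_map (measurable_fadingState h_meas g_meas).aemeasurable
    (measurable_sumRateSIC measurable_fst hP).aestronglyMeasurable).symm

theorem ergodicSumRateNoSIC_eq_integral_map (h_meas : ∀ i, Measurable (h i))
    (g_meas : ∀ i, Measurable (g i)) (hP : Measurable P) :
    ergodicSumRateNoSIC μ h g N P =
      ∫ s : FadingState K, sumRateNoSIC N s.1 (P s) ∂μ.map (fadingState h g) :=
  (integral_map (measurable_fadingState h_meas g_meas).aemeasurable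
    (measurable_sumRateNoSIC measurable_fst hP).aestronglyMeasurable).symm

/-- The change of variables uses measurability of the allocation, so the objectives are identified
only on the feasible set, which is all that maximality over it involves. -/
theorem isOptimalSIC_iff (h_meas : ∀ i, Measurable (h i)) (g_meas : ∀ i, Measurable (g i)) :
    IsOptimalSIC μ h g N Pav Iav P ↔
      P ∈ powerFeasible (μ.map (fadingState h g)) (fun s : FadingState K => s.2) Pav Iav ∧
      IsMaxOn (fun P => ∫ s : FadingState K, sumRateSIC N s.1 (P s) ∂μ.map (fadingState h g))
        (powerFeasible (μ.map (fadingState h g)) (fun s : FadingState K => s.2) Pav Iav) P := by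
  rw [IsOptimalSIC, feasibleSet_eq_powerFeasible h_meas g_meas]
  refine and_congr_right fun hP => ?_
  simp only [isMaxOn_iff]
  refine forall₂_congr fun Q hQ => ?_
  rw [ergodicSumRateSIC_eq_integral_map h_meas g_meas hP.1,
    ergodicSumRateSIC_eq_integral_map h_meas g_meas hQ.1]

theorem isOptimalNoSIC_iff (h_meas : ∀ i, Measurable (h i)) (g_meas : ∀ i, Measurable (g i)) :
    IsOptimalNoSIC μ h g N Pav Iav P ↔
      P ∈ powerFeasible (μ.map (fadingState h g)) (fun s : FadingState K => s.2) Pav Iav ∧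
      IsMaxOn (fun P => ∫ s : FadingState K, sumRateNoSIC N s.1 (P s) ∂μ.map (fadingState h g))
        (powerFeasible (μ.map (fadingState h g)) (fun s : FadingState K => s.2) Pav Iav) P := by
  rw [IsOptimalNoSIC, feasibleSet_eq_powerFeasible h_meas g_meas]
  refine and_congr_right fun hP => ?_
  simp only [isMaxOn_iff]
  refine forall₂_congr fun Q hQ => ?_
  rw [ergodicSumRateNoSIC_eq_integral_map h_meas g_meas hP.1,
    ergodicSumRateNoSIC_eq_integral_map h_meas g_meas hQ.1]

end Transfer

/-! ### The main theorem -/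

theorem theorem1 {Ω : Type*} [MeasurableSpace Ω] (μ : Measure Ω) [IsProbabilityMeasure μ]
    {K : ℕ} (h g : Fin K → Ω → ℝ)
    (h_meas : ∀ i, Measurable (h i)) (g_meas : ∀ i, Measurable (g i))
    (h_nonneg : ∀ i, ∀ᵐ ω ∂μ, 0 ≤ h i ω) (g_nonneg : ∀ i, ∀ᵐ ω ∂μ, 0 ≤ g i ω)
    (indep : iIndepFun (Sum.elim h g) μ)
    (ident : ∀ a b, IdentDistrib (Sum.elim h g a) (Sum.elim h g b) μ μ)
    (h_pdf : ∀ i, HasPDF (h i) μ volume) (g_pdf : ∀ i, HasPDF (g i) μ volume)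
    (h_log : ∀ i, Integrable (fun ω => Real.log (1 + h i ω)) μ)
    (N : ℝ) (hN : 0 < N)
    (Pav : Fin K → ℝ) (hPav : ∀ i, 0 ≤ Pav i) (Iav : ℝ) (hIav : 0 ≤ Iav) :
    (∀ P ∈ feasibleSet μ h g Pav Iav,
      Integrable (fun ω => sumRateNoSIC N (fun i => h i ω) (P (fadingState h g ω))) μ ∧
      Integrable (fun ω => sumRateSIC N (fun i => h i ω) (P (fadingState h g ω))) μ) ∧
    (∃ P, IsOptimalNoSIC μ h g N Pav Iav P) ∧
    (∀ P, IsOptimalNoSIC μ h g N Pav Iav P ↔ IsOptimalSIC μ h g N Pav Iav P) ∧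
    (∀ P, IsOptimalNoSIC μ h g N Pav Iav P → IsDynamicTDMA μ h g P) ∧
    (∀ P Q, IsOptimalNoSIC μ h g N Pav Iav P → IsOptimalNoSIC μ h g N Pav Iav Q →
      ∀ᵐ ω ∂μ, P (fadingState h g ω) = Q (fadingState h g ω)) := by
  have hX := measurable_fadingState h_meas g_meas
  set ν := μ.map (fadingState h g) with hν
  have : IsProbabilityMeasure ν := Measure.isProbabilityMeasure_map hX.aemeasurable
  have mh : ∀ i, Measurable fun s : FadingState K => s.1 i := fun i =>
    (measurable_pi_apply i).comp measurable_fst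
  have mg : ∀ i, Measurable fun s : FadingState K => s.2 i := fun i =>
    (measurable_pi_apply i).comp measurable_snd
  -- A law with a density has no atom at 0, so the nonnegative gains are almost surely positive.
  have hpos : ∀ᵐ s ∂ν, ∀ i, 0 < s.1 i := by
    rw [ae_all_iff]
    intro i
    rw [hν, ae_map_iff hX.aemeasurable (measurableSet_lt measurable_const (mh i))]
    have hne := ae_ne_of_indepFun (h_meas i) (measurable_const (a := (0 : ℝ)))
      (indepFun_const_left (0 : ℝ) (h i)) (map_singleton_eq_zero_of_hasPDF (h_pdf i)) measurable_id
    filter_upwards [h_nonneg i, hne] with ω h0 h1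
    exact lt_of_le_of_ne h0 (Ne.symm h1)
  have hh : ∀ᵐ s ∂ν, ∀ i, 0 ≤ s.1 i := by
    filter_upwards [hpos] with s hs i using (hs i).le
  have hg : ∀ᵐ s ∂ν, ∀ i, 0 ≤ s.2 i := by
    rw [ae_all_iff]
    intro i
    rw [hν, ae_map_iff hX.aemeasurable (measurableSet_le measurable_const (mg i))]
    exact g_nonneg i
  have hlog : ∀ i, Integrable (fun s : FadingState K => Real.log (1 + s.1 i)) ν := fun i =>
    (integrable_map_measure (Real.measurable_log.comp ((mh i).const_add 1)).aestronglyMeasurable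
      hX.aemeasurable).2 (h_log i)
  have hgen : ∀ i j, i ≠ j → ∀ c : Fin 3 → ℝ, c ≠ 0 → ∀ᵐ s ∂ν,
      c 0 * s.1 j + c 1 * s.1 i + c 2 * (s.2 i * s.1 j - s.2 j * s.1 i) ≠ 0 := by
    intro i j hij c hc
    rw [hν, ae_map_iff hX.aemeasurable]
    · exact ae_gain_combination_ne_zero h_meas g_meas indep h_pdf g_pdf hij hc
    · exact (measurableSet_eq_fun ((((mh j).const_mul _).add ((mh i).const_mul _)).add
        ((((mg i).mul (mh j)).sub ((mg j).mul (mh i))).const_mul _)) measurable_const).compl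
  have hone := fun (P : PowerAllocation K) hP hmax => ae_at_most_one_active (ν := ν) (P := P)
    (h := fun s => s.1) (g := fun s => s.2) (Pav := Pav) (Iav := Iav) hN measurable_fst hpos hlog
    measurable_snd hgen hP hmax
  obtain ⟨R, hR, hRmax⟩ := exists_isMaxOn_integral_sumRateSIC (ν := ν) (h := fun s => s.1)
    (g := fun s => s.2) hN measurable_fst hh hlog measurable_snd hg hPav hIav
  have hiff : ∀ P, IsOptimalNoSIC μ h g N Pav Iav P ↔ IsOptimalSIC μ h g N Pav Iav P := fun P => by
    rw [isOptimalSIC_iff h_meas g_meas, isOptimalNoSIC_iff h_meas g_meas]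
    exact and_congr_right fun hP =>
      isMaxOn_sumRateNoSIC_iff hN measurable_fst hh hlog hR hRmax hone hP
  refine ⟨fun P hP => ?_, ⟨R, (hiff R).2 ((isOptimalSIC_iff h_meas g_meas).2 ⟨hR, hRmax⟩)⟩, hiff,
    fun P hP => ?_, fun P Q hP hQ => ?_⟩
  · rw [feasibleSet_eq_powerFeasible h_meas g_meas] at hP
    exact ⟨(integrable_sumRateNoSIC hN measurable_fst hh hlog hP).comp_measurable hX,
      (integrable_sumRateSIC hN measurable_fst hh hlog hP).comp_measurable hX⟩
  · obtain ⟨hPf, hPm⟩ := (isOptimalSIC_iff h_meas g_meas).1 ((hiff P).1 hP)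
    exact ae_of_ae_map hX.aemeasurable (hone P hPf hPm)
  · obtain ⟨hPf, hPm⟩ := (isOptimalSIC_iff h_meas g_meas).1 ((hiff P).1 hP)
    obtain ⟨hQf, hQm⟩ := (isOptimalSIC_iff h_meas g_meas).1 ((hiff Q).1 hQ)
    exact ae_of_ae_map hX.aemeasurable (ae_eq_of_isMaxOn hN measurable_fst hpos hlog
      measurable_snd hgen hPf hPm hQf hQm)
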